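/- All graphs are finite and simple. For an integer $t$, a graph is $C_{\ge t}$-free if it has no induced subgraph isomorphic to a cycle with at least $t$ vertices (a cycle having at least three vertices). A graph is $d$-degenerate if every non-empty induced subgraph of it contains a vertex whose degree in that subgraph is at most $d$; its degeneracy is the minimum $d \in \mathbb{N}$ for which it is $d$-degenerate. There is a function $f\colon \mathbb{N}\to\mathbb{N}$ such that, for all $t,\ell \in \mathbb{N}$, every $C_{\ge t}$-free graph that does not contain the complete bipartite graph $K_{\ell,\ell}$ as a (not necessarily induced) subgraph has degeneracy at most $\ell^{f(t)}$. -/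

import Mathlib

namespace SimpleGraph

/-- `G` is `C_{≥ t}`-free: no cycle with at least `t` vertices (a cycle has at least three
vertices) is isomorphic to an induced subgraph of `G`. -/
def LongInducedCycleFree {V : Type*} (G : SimpleGraph V) (t : ℕ) : Prop :=
  ∀ n : ℕ, 3 ≤ n → t ≤ n → ¬ (cycleGraph n).IsIndContained G

/-- `G` is `d`-degenerate: every (nonempty) induced subgraph of `G` contains a vertex whose
degree in that subgraph is at most `d`. -/
def IsDegenerate {V : Type*} (G : SimpleGraph V) (d : ℕ) : Prop :=
  ∀ s : Set V, s.Nonempty → ∃ v : s, ((G.induce s).neighborSet v).encard ≤ (d : ℕ∞)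

/-- The degeneracy of `G`: the least `d` for which `G` is `d`-degenerate
(and `⊤` if there is none, which does not happen for finite graphs). -/
noncomputable def degeneracy {V : Type*} (G : SimpleGraph V) : ℕ∞ :=
  ⨅ d ∈ {d : ℕ | G.IsDegenerate d}, (d : ℕ∞)

end SimpleGraph

/-!
Let `G` be a graph without a `K_{ℓ,ℓ}` subgraph and without long induced cycles. All quantities
are compared with powers of a number `x` that is at least a large power of `ℓ`. Stable means
independent.

**Genericity.** If `W` is a large set, then fewer than `ℓ` vertices see more than a `1 - 1 / x`
fraction of `W`, since otherwise `ℓ` of them would have many common neighbours in `W`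
(`BicliqueFree.card_almostComplete_lt`). Consequently, almost all tuples of a fixed length are
generic (`BicliqueFree.card_not_generic`): if two of the entries form a heavy pair, that is, have
many common neighbours, then they still have many common neighbours not seen by any other entry.
Moreover, a polynomial fraction of all tuples is stable, and large sets have stable transversals.
A stable generic tuple whose cyclically consecutive entries form heavy pairs therefore extends to
an induced cycle of twice its length (`IsTame.not_forall_heavy`). By double counting, adjacent
pairs (`IsTame.sum_adj_lt`) and then heavy pairs (`IsTame.sum_heavy_lt`) are rare in every set of
polynomial size. Pairs of either kind are called crowded.

**Unbalanced pairs.** Suppose that `G` is `d`-degenerate and that each vertex of `B` has about `d`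
neighbours in `A`. Most pairs of neighbours are not crowded. Sampling `A` with probability about
`1 / d`, many of these pairs become exactly the trace of some vertex of `B` on the sample; a long
cycle in the graph formed by these traces is an induced cycle of `G` of twice the length. It
follows that `B` is not larger than `A` by more than a fixed power of `x`
(`IsTame.card_le_of_nbrs`).

**Almost regular graphs.** If the maximum degree exceeds the average degree only by a fixed power
of `x`, consider a random induced subgraph whose average degree is a suitable power of `x`. Its
expected number of cycles of bounded length is small: crowded pairs in a neighbourhood are rare,
and for a pair that is not crowded a path joining its ends closes to a cycle in few ways. Removing
a vertex from each short cycle leaves more edges than vertices, hence a cycle, and a shortest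
cycle is induced and long (`sum_adj_le_of_almost_regular`).

**Degenerate graphs.** Let `d` be the degeneracy, so that some induced subgraph is `d`-degenerate
with minimum degree at least `d`. If `d` is a large power of `x`, the bound for unbalanced pairs
shows that the vertices of degree far above `d` can be removed while most of the others keep half
of their neighbours, and what remains is almost regular, which is impossible
(`IsTame.false_of_minDegree`).
-/

open Finset

-- the sections fix finiteness and decidability assumptions that some of their lemmas do not need
set_option linter.unusedSectionVars false

namespace SimpleGraph

/-! ### Cycles as cyclic sequences -/

/-- `c 0, …, c (L - 1)` are the vertices of a (not necessarily induced) cycle of `H`, in cyclic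
order and all in `A`; the values of `c` from `L` on are irrelevant. -/
structure IsCyclicSeq {V : Type*} (H : SimpleGraph V) (A : Finset V) (L : ℕ) (c : ℕ → V) :
    Prop where
  three_le : 3 ≤ L
  mem : ∀ i < L, c i ∈ A
  inj : ∀ i < L, ∀ j < L, c i = c j → i = j
  adj : ∀ i, i + 1 < L → H.Adj (c i) (c (i + 1))
  close : H.Adj (c (L - 1)) (c 0)

section Cycles

variable {V : Type*}

theorem cycleGraph_adj_iff_val {n : ℕ} (hn : 3 ≤ n) (u v : Fin n) (huv : u.val < v.val) :
    (cycleGraph n).Adj u v ↔ v.val = u.val + 1 ∨ (u.val = 0 ∧ v.val + 1 = n) := by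
  obtain ⟨u, hu⟩ := u
  obtain ⟨v, hv⟩ := v
  simp only at huv
  rw [cycleGraph_adj']
  simp only [Fin.sub_def]
  have h1 : (n - v + u) % n = n - v + u := Nat.mod_eq_of_lt (by omega)
  have h2 : (n - u + v) % n = v - u := by
    rw [show n - u + v = (v - u) + n by omega, Nat.add_mod_right, Nat.mod_eq_of_lt (by omega)]
  rw [h1, h2]
  omega

theorem isIndContained_cycleGraph_of_seq {G : SimpleGraph V} {n : ℕ} (hn : 3 ≤ n) (c : ℕ → V)
    (hinj : ∀ i j, i < j → j < n → c i ≠ c j)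
    (hadj : ∀ i j, i < j → j < n → (G.Adj (c i) (c j) ↔ j = i + 1 ∨ (i = 0 ∧ j + 1 = n))) :
    (cycleGraph n).IsIndContained G := by
  refine ⟨⟨⟨fun i : Fin n => c i, ?_⟩, ?_⟩⟩
  · intro i j hij
    by_contra hne
    rcases lt_or_gt_of_ne (fun h => hne (Fin.ext h)) with h | h
    · exact hinj i j h j.2 hij
    · exact hinj j i h i.2 hij.symm
  · intro i j
    change G.Adj (c i) (c j) ↔ (cycleGraph n).Adj i j
    rcases lt_trichotomy i.val j.val with h | h | h
    · rw [hadj i j h j.2, cycleGraph_adj_iff_val hn i j h]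
    · have : i = j := Fin.ext h
      subst this
      simp
    · rw [G.adj_comm, (cycleGraph n).adj_comm, hadj j i h i.2, cycleGraph_adj_iff_val hn j i h]

/-- The subdivision of a cycle: if the `β i` see among the `α j` exactly the two cyclically
consecutive ones `α i` and `α (i + 1)`, then `α 0, β 0, α 1, β 1, …` is an induced cycle. -/
theorem isIndContained_cycleGraph_of_subdivision {G : SimpleGraph V} {L : ℕ} (hL : 3 ≤ L)
    (α β : ℕ → V)
    (hα : ∀ i j, i < j → j < L → α i ≠ α j) (hβ : ∀ i j, i < j → j < L → β i ≠ β j)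
    (hαs : ∀ i j, i < j → j < L → ¬ G.Adj (α i) (α j))
    (hβs : ∀ i j, i < j → j < L → ¬ G.Adj (β i) (β j))
    (hαβ : ∀ i j, i < L → j < L →
      (G.Adj (β i) (α j) ↔ j = i ∨ j = i + 1 ∨ (i + 1 = L ∧ j = 0))) :
    (cycleGraph (2 * L)).IsIndContained G := by
  have hαs' : ∀ i j, i < L → j < L → ¬ G.Adj (α i) (α j) := by
    intro i j hi hj
    rcases lt_trichotomy i j with h | h | h
    · exact hαs i j h hj
    · subst h; exact G.irrefl
    · rw [G.adj_comm]; exact hαs j i h hi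
  have hne : ∀ i j, i < L → j < L → α i ≠ β j := by
    intro i j hi hj h
    have := (hαβ j j hj hj).2 (Or.inl rfl)
    rw [← h] at this
    exact hαs' i j hi hj this
  refine isIndContained_cycleGraph_of_seq (by omega)
    (fun i => if i % 2 = 0 then α (i / 2) else β (i / 2)) ?_ ?_
  · intro i j hij hj
    by_cases hi2 : i % 2 = 0 <;> by_cases hj2 : j % 2 = 0 <;>
      simp only [hi2, hj2, if_true, if_false]
    · exact hα _ _ (by omega) (by omega)
    · exact hne _ _ (by omega) (by omega)
    · exact (hne _ _ (by omega) (by omega)).symm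
    · exact hβ _ _ (by omega) (by omega)
  · intro i j hij hj
    by_cases hi2 : i % 2 = 0 <;> by_cases hj2 : j % 2 = 0 <;>
      simp only [hi2, hj2, if_true, if_false]
    · have := hαs (i / 2) (j / 2) (by omega) (by omega)
      simp only [this, false_iff]
      omega
    · rw [G.adj_comm, hαβ _ _ (by omega) (by omega)]
      omega
    · rw [hαβ _ _ (by omega) (by omega)]
      omega
    · have := hβs (i / 2) (j / 2) (by omega) (by omega)
      simp only [this, false_iff]
      omega

/-- A shortest cyclic sequence in `A` is an induced cycle, because a chord would split off a
shorter one. -/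
theorem IsCyclicSeq.exists_isIndContained {G : SimpleGraph V} {A : Finset V} {L : ℕ} {c : ℕ → V}
    (h : G.IsCyclicSeq A L c) {t : ℕ} (hshort : ∀ L c, G.IsCyclicSeq A L c → t ≤ L) :
    ∃ n, 3 ≤ n ∧ t ≤ n ∧ (cycleGraph n).IsIndContained G := by
  classical
  have hex : ∃ L, ∃ c, G.IsCyclicSeq A L c := ⟨L, c, h⟩
  obtain ⟨c, hc⟩ := Nat.find_spec hex
  have hmin := fun n (hn : n < Nat.find hex) => Nat.find_min hex hn
  generalize Nat.find hex = n at hc hmin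
  refine ⟨n, hc.three_le, hshort n c hc, isIndContained_cycleGraph_of_seq hc.three_le c ?_ ?_⟩
  · intro i j hij hj he
    exact absurd (hc.inj i (by omega) j hj he) (by omega)
  · intro i j hij hj
    constructor
    · intro hadj
      by_contra hcon
      push Not at hcon
      refine hmin (j - i + 1) (by omega) ⟨fun k => c (i + k), by omega, ?_, ?_, ?_, ?_⟩
      · intro k hk; exact hc.mem _ (by omega)
      · intro k hk l hl hkl
        have := hc.inj _ (by omega) _ (by omega) hkl
        omega
      · intro k hk; exact hc.adj (i + k) (by omega)
      · simp only [Nat.add_sub_cancel, Nat.add_zero]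
        rw [show i + (j - i) = j by omega]
        exact hadj.symm
    · rintro (rfl | ⟨rfl, hj'⟩)
      · exact hc.adj _ hj
      · rw [show j = n - 1 by omega]
        exact hc.close.symm

variable [DecidableEq V]

/-- Minimum degree more than `m ≥ 1` gives a cycle of length at least `m + 2`: take a longest path;
all neighbours of its last vertex lie on it. -/
theorem exists_isCyclicSeq_of_minDegree (H : SimpleGraph V) [DecidableRel H.Adj] {A : Finset V}
    (hA : A.Nonempty) {m : ℕ} (hm : 1 ≤ m) (hdeg : ∀ a ∈ A, m < #{b ∈ A | H.Adj a b}) :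
    ∃ L c, m + 2 ≤ L ∧ H.IsCyclicSeq A L c := by
  classical
  let P : ℕ → Prop := fun p => ∃ c : ℕ → V, (∀ i < p + 1, c i ∈ A) ∧
    (∀ i < p + 1, ∀ j < p + 1, c i = c j → i = j) ∧ ∀ i, i + 1 < p + 1 → H.Adj (c i) (c (i + 1))
  have hbound : ∀ p, P p → p ≤ #A := by
    rintro p ⟨c, hmem, hinj, -⟩
    have := card_le_card_of_injOn (s := range (p + 1)) (t := A) c
      (fun i hi => hmem i (mem_range.1 hi))
      (fun i hi j hj hij => hinj i (mem_range.1 hi) j (mem_range.1 hj) hij)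
    rw [card_range] at this
    omega
  have hP0 : P 0 := by
    obtain ⟨a, ha⟩ := hA
    exact ⟨fun _ => a, fun _ _ => ha, fun i hi j hj _ => by omega, fun i hi => by omega⟩
  have hmax := Nat.findGreatest_spec (P := P) (Nat.zero_le #A) hP0
  have hno : ¬ P (Nat.findGreatest P #A + 1) := fun h => by
    have := Nat.le_findGreatest (hbound _ h) h
    omega
  generalize Nat.findGreatest P #A = p at hmax hno
  obtain ⟨c, hmem, hinj, hadj⟩ := hmax
  have hsub : {b ∈ A | H.Adj (c p) b} ⊆ (range p).image c := by
    intro b hb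
    rw [mem_filter] at hb
    by_contra hbc
    have hbc' : ∀ i < p + 1, c i ≠ b := by
      intro i hi he
      rcases Nat.lt_succ_iff_lt_or_eq.1 hi with h | h
      · exact hbc (mem_image.2 ⟨i, mem_range.2 h, he⟩)
      · subst h
        rw [he] at hb
        exact H.irrefl hb.2
    refine hno ⟨fun i => if i = p + 1 then b else c i, ?_, ?_, ?_⟩
    · intro i hi
      by_cases h : i = p + 1
      · simp [h, hb.1]
      · simpa [h] using hmem i (by omega)
    · intro i hi j hj
      by_cases h : i = p + 1 <;> by_cases h' : j = p + 1 <;> simp only [h, h', if_true, if_false]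
      · simp
      · intro he; exact absurd he.symm (hbc' j (by omega))
      · intro he; exact absurd he (hbc' i (by omega))
      · exact hinj i (by omega) j (by omega)
    · intro i hi
      by_cases h : i = p
      · subst h; simpa using hb.2
      · have h1 : i ≠ p + 1 := by omega
        simpa [h, h1] using hadj i (by omega)
  -- the neighbours occupy more than `m` of the positions below `p`, so one is at most `p - 1 - m`
  have hex : ∃ i, i + m + 1 ≤ p ∧ H.Adj (c p) (c i) := by
    by_contra hcon
    push Not at hcon
    have hsub' : {b ∈ A | H.Adj (c p) b} ⊆ (Ico (p - m) p).image c := by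
      intro b hb
      obtain ⟨i, hi, rfl⟩ := mem_image.1 (hsub hb)
      refine mem_image.2 ⟨i, ?_, rfl⟩
      rw [mem_range] at hi
      rw [mem_Ico]
      refine ⟨?_, hi⟩
      by_contra hlt
      exact hcon i (by omega) (mem_filter.1 hb).2
    have h1 := card_le_card hsub'
    have h2 : #((Ico (p - m) p).image c) ≤ #(Ico (p - m) p) := card_image_le
    rw [Nat.card_Ico] at h2
    have h3 := hdeg (c p) (hmem p (by omega))
    omega
  obtain ⟨i, hi, hci⟩ := hex
  refine ⟨p - i + 1, fun k => c (i + k), by omega, by omega, ?_, ?_, ?_, ?_⟩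
  · intro k hk; exact hmem _ (by omega)
  · intro k hk l hl hkl
    have := hinj _ (by omega) _ (by omega) hkl
    omega
  · intro k hk; exact hadj (i + k) (by omega)
  · simp only [Nat.add_sub_cancel, Nat.add_zero]
    rw [show i + (p - i) = p by omega]
    exact hci

theorem sum_card_filter_adj_erase (H : SimpleGraph V) [DecidableRel H.Adj] (A : Finset V) {a : V}
    (ha : a ∈ A) :
    ∑ u ∈ A, #{v ∈ A | H.Adj u v} =
      ∑ u ∈ A.erase a, #{v ∈ A.erase a | H.Adj u v} + 2 * #{v ∈ A | H.Adj a v} := by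
  have h1 : ∀ u ∈ A.erase a, #{v ∈ A | H.Adj u v} =
      #{v ∈ A.erase a | H.Adj u v} + if H.Adj a u then 1 else 0 := by
    intro u _
    have hA : A = insert a (A.erase a) := (insert_erase ha).symm
    conv_lhs => rw [hA]
    rw [filter_insert]
    by_cases h : H.Adj u a
    · rw [if_pos h, card_insert_of_notMem (by simp), if_pos h.symm]
    · rw [if_neg h, if_neg (fun h' => h h'.symm), add_zero]
  rw [← add_sum_erase A _ ha, sum_congr rfl h1, sum_add_distrib, ← card_filter]
  have h2 : #{u ∈ A.erase a | H.Adj a u} = #{v ∈ A | H.Adj a v} := by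
    congr 1
    ext u
    simp only [mem_filter, mem_erase]
    refine ⟨fun h => ⟨h.1.2, h.2⟩, fun h => ⟨⟨fun he => ?_, h.1⟩, h.2⟩⟩
    subst he
    exact H.irrefl h.2
  omega

/-- Average degree more than `2 m` gives a nonempty part with minimum degree more than `m`. -/
theorem exists_minDegree_of_sum (H : SimpleGraph V) [DecidableRel H.Adj] {m : ℕ} (A : Finset V)
    (h : 2 * m * #A < ∑ u ∈ A, #{v ∈ A | H.Adj u v}) :
    ∃ B ⊆ A, B.Nonempty ∧ ∀ a ∈ B, m < #{b ∈ B | H.Adj a b} := by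
  induction A using Finset.strongInduction with
  | H A ih =>
    by_cases hA : ∀ a ∈ A, m < #{b ∈ A | H.Adj a b}
    · refine ⟨A, Subset.rfl, ?_, hA⟩
      by_contra hne
      rw [not_nonempty_iff_eq_empty] at hne
      subst hne
      simp at h
    · push Not at hA
      obtain ⟨a, ha, hle⟩ := hA
      have h1 := sum_card_filter_adj_erase H A ha
      have h2 := card_erase_add_one ha
      obtain ⟨B, hB, hB'⟩ := ih (A.erase a) (erase_ssubset ha) (by
        rw [← h2] at h
        nlinarith)
      exact ⟨B, hB.trans (erase_subset _ _), hB'⟩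

end Cycles

/-! ### Genericity in graphs without large bicliques -/

/-- `G` has no `K_{ℓ,ℓ}` subgraph, in terms of vertex sets. -/
def BicliqueFree {V : Type*} (G : SimpleGraph V) (ℓ : ℕ) : Prop :=
  ∀ X Y : Finset V, #X = ℓ → #Y = ℓ → ∃ u ∈ X, ∃ w ∈ Y, ¬ G.Adj u w

section Generic

variable {V : Type*} [Fintype V] [DecidableEq V] (G : SimpleGraph V) [DecidableRel G.Adj]

/-- The vertices whose neighbourhood misses less than a `1 / x` fraction of `W`. -/
def almostComplete (x : ℕ) (W : Finset V) : Finset V :=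
  {v | x * #{w ∈ W | ¬ G.Adj v w} < #W}

/-- The number of common neighbours. -/
def codeg (u v : V) : ℕ := #{w | G.Adj u w ∧ G.Adj v w}

/-- The common neighbours of `a i` and `a i'` that are adjacent to no `a j` with `j ∈ J`. -/
def privateNbrs {ι : Type*} (a : ι → V) (i i' : ι) (J : Finset ι) : Finset V :=
  {w | (G.Adj (a i) w ∧ G.Adj (a i') w) ∧ ∀ j ∈ J, ¬ G.Adj (a j) w}

/-- The entries of the tuple are distinct and pairwise nonadjacent. -/
def IsStableTuple {ι : Type*} (a : ι → V) : Prop :=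
  ∀ i j, i ≠ j → a i ≠ a j ∧ ¬ G.Adj (a i) (a j)

/-- Each entry of the tuple misses at least a `1 / x` fraction of every set of common neighbours of
two other entries, also after the neighbours of some further entries have been removed. -/
def IsGenericTuple (x : ℕ) {ι : Type*} [DecidableEq ι] (a : ι → V) : Prop :=
  ∀ i i' j J, j ≠ i → j ≠ i' → j ∉ J → x ≤ #(G.privateNbrs a i i' J) →
    #(G.privateNbrs a i i' J) ≤ x * #(G.privateNbrs a i i' (insert j J))

variable {G} {ℓ x : ℕ}

theorem codeg_comm (u v : V) : G.codeg u v = G.codeg v u := by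
  simp only [codeg, and_comm]

/-- Many vertices, each missing only a small fraction of `W`, would leave a large part of `W`
complete to all of them. -/
theorem BicliqueFree.card_almostComplete_lt (hB : G.BicliqueFree ℓ) (hx : 2 * ℓ ≤ x)
    {W : Finset V} (hW : x ≤ #W) : #(G.almostComplete x W) < ℓ := by
  by_contra hcon
  push Not at hcon
  obtain ⟨X, hX, hXc⟩ := exists_subset_card_eq hcon
  set Y := {w ∈ W | ∀ v ∈ X, G.Adj v w} with hY
  have h1 : {w ∈ W | ¬ ∀ v ∈ X, G.Adj v w} ⊆ X.biUnion fun v => {w ∈ W | ¬ G.Adj v w} := by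
    intro w hw
    simp only [mem_filter, mem_biUnion] at hw ⊢
    obtain ⟨hw, hv⟩ := hw
    push Not at hv
    obtain ⟨v, hv, hvw⟩ := hv
    exact ⟨v, hv, hw, hvw⟩
  have h2 := (card_le_card h1).trans card_biUnion_le
  have h3 : x * ∑ v ∈ X, #{w ∈ W | ¬ G.Adj v w} ≤ ℓ * #W := by
    rw [mul_sum, ← hXc, ← smul_eq_mul (#X), ← sum_const]
    refine sum_le_sum fun v hv => ?_
    have := hX hv
    rw [almostComplete, mem_filter] at this
    exact this.2.le
  have h4 := card_filter_add_card_filter_not (s := W) (fun w => ∀ v ∈ X, G.Adj v w)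
  rw [← hY] at h4
  have h5 : ℓ ≤ #Y := by
    rcases Nat.eq_zero_or_pos ℓ with h0 | h0
    · omega
    · have h6 : 2 * ℓ * #{w ∈ W | ¬ ∀ v ∈ X, G.Adj v w} ≤ ℓ * #W :=
        (Nat.mul_le_mul hx h2).trans h3
      have h7 : 2 * #{w ∈ W | ¬ ∀ v ∈ X, G.Adj v w} ≤ #W := by
        refine Nat.le_of_mul_le_mul_left ?_ h0
        linarith
      omega
  obtain ⟨Z, hZ, hZc⟩ := exists_subset_card_eq h5
  obtain ⟨u, hu, w, hw, huw⟩ := hB X Z hXc hZc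
  have := hZ hw
  rw [hY, mem_filter] at this
  exact huw (this.2 u hu)

theorem le_mul_of_notMem_almostComplete {W : Finset V} {v : V} (hv : v ∉ G.almostComplete x W) :
    #W ≤ x * #{w ∈ W | ¬ G.Adj v w} := by
  rw [almostComplete, mem_filter] at hv
  push Not at hv
  exact hv (mem_univ _)

/-- Large sets `W i` have a stable system of distinct representatives. -/
theorem BicliqueFree.exists_stable_transversal (hB : G.BicliqueFree ℓ) (hx : 2 * ℓ ≤ x)
    (hx2 : 2 ≤ x) [Nonempty V] {ι : Type*} [DecidableEq ι] (I : Finset ι) (W : ι → Finset V)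
    (hW : ∀ i ∈ I, x ^ (2 * #I + 1) ≤ #(W i)) :
    ∃ b : ι → V, (∀ i ∈ I, b i ∈ W i) ∧
      ∀ i ∈ I, ∀ j ∈ I, i ≠ j → b i ≠ b j ∧ ¬ G.Adj (b i) (b j) := by
  induction I using Finset.induction_on generalizing W with
  | empty =>
    exact ⟨fun _ => Classical.arbitrary V, by simp, by simp⟩
  | insert i₀ I hi₀ ih =>
    rw [card_insert_of_notMem hi₀] at hW
    have hx1 : 1 ≤ x := by omega
    have hbad : #(I.biUnion fun i => G.almostComplete x (W i)) < #(W i₀) := by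
      calc #(I.biUnion fun i => G.almostComplete x (W i))
          ≤ ∑ i ∈ I, #(G.almostComplete x (W i)) := card_biUnion_le
        _ ≤ ∑ _i ∈ I, x := by
            refine sum_le_sum fun i hi => ?_
            have h1 : x ≤ #(W i) := (Nat.le_self_pow (by omega) x).trans
              (hW i (mem_insert_of_mem hi))
            have := hB.card_almostComplete_lt hx h1
            omega
        _ = #I * x := by rw [sum_const, smul_eq_mul]
        _ < x ^ #I * x := by
            have := Nat.lt_pow_self (n := #I) (a := x) (by omega)
            exact Nat.mul_lt_mul_of_pos_right this (by omega)
        _ = x ^ (#I + 1) := by ring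
        _ ≤ x ^ (2 * (#I + 1) + 1) := Nat.pow_le_pow_right hx1 (by omega)
        _ ≤ #(W i₀) := hW i₀ (mem_insert_self _ _)
    obtain ⟨b₀, hb₀, hb₀'⟩ := exists_mem_notMem_of_card_lt_card hbad
    simp only [mem_biUnion, not_exists, not_and] at hb₀'
    obtain ⟨b, hb, hbs⟩ := ih (fun i => ({w ∈ W i | ¬ G.Adj b₀ w}).erase b₀) (by
      intro i hi
      have h1 := (hW i (mem_insert_of_mem hi)).trans
        (le_mul_of_notMem_almostComplete (hb₀' i hi))
      have h2 : x ^ (2 * #I + 2) ≤ #{w ∈ W i | ¬ G.Adj b₀ w} := by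
        refine Nat.le_of_mul_le_mul_left (c := x) ?_ (by omega)
        refine le_trans (le_of_eq ?_) h1
        ring
      have h3 := pred_card_le_card_erase (a := b₀) (s := {w ∈ W i | ¬ G.Adj b₀ w})
      have h4 : 2 * x ^ (2 * #I + 1) ≤ x ^ (2 * #I + 2) := by
        rw [pow_succ x (2 * #I + 1), mul_comm]
        exact Nat.mul_le_mul_left _ hx2
      have h5 : 1 ≤ x ^ (2 * #I + 1) := Nat.one_le_pow _ _ hx1
      omega)
    have hb' : ∀ i ∈ I, b i ∈ W i ∧ b₀ ≠ b i ∧ ¬ G.Adj b₀ (b i) := by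
      intro i hi
      have := hb i hi
      rw [mem_erase, mem_filter] at this
      exact ⟨this.2.1, this.1.symm, this.2.2⟩
    have hne : ∀ i ∈ I, i ≠ i₀ := fun i hi h => hi₀ (h ▸ hi)
    refine ⟨Function.update b i₀ b₀, ?_, ?_⟩
    · intro i hi
      rcases mem_insert.1 hi with rfl | hi
      · simpa using hb₀
      · rw [Function.update_of_ne (hne i hi)]
        exact (hb' i hi).1
    · intro i hi j hj hij
      by_cases hi' : i = i₀ <;> by_cases hj' : j = i₀
      · exact absurd (hi'.trans hj'.symm) hij
      · have hj := (mem_insert.1 hj).resolve_left hj'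
        rw [hi', Function.update_self, Function.update_of_ne hj']
        exact (hb' j hj).2
      · have hi := (mem_insert.1 hi).resolve_left hi'
        rw [hj', Function.update_self, Function.update_of_ne hi']
        exact ⟨(hb' i hi).2.1.symm, fun h => (hb' i hi).2.2 h.symm⟩
      · rw [Function.update_of_ne hi', Function.update_of_ne hj']
        exact hbs i ((mem_insert.1 hi).resolve_left hi') j ((mem_insert.1 hj).resolve_left hj') hij

/-- The stable tuples with entries in `N`. -/
def stableTuples (G : SimpleGraph V) [DecidableRel G.Adj] (ι : Type*) [Fintype ι] [DecidableEq ι]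
    (N : Finset V) : Finset (ι → V) :=
  {a ∈ Fintype.piFinset fun _ => N | ∀ i j, i ≠ j → a i ≠ a j ∧ ¬ G.Adj (a i) (a j)}

theorem mem_stableTuples {ι : Type*} [Fintype ι] [DecidableEq ι] {N : Finset V} {a : ι → V} :
    a ∈ G.stableTuples ι N ↔ (∀ i, a i ∈ N) ∧ G.IsStableTuple a := by
  rw [stableTuples, mem_filter, Fintype.mem_piFinset, IsStableTuple]

/-- A positive fraction, polynomial in `1 / x`, of all `m`-tuples in a large set are stable:
choose the entries one by one, each outside the almost complete vertices. -/
theorem BicliqueFree.pow_card_le_card_stableTuples_fin (hB : G.BicliqueFree ℓ) (hx : 2 * ℓ ≤ x)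
    (hx2 : 2 ≤ x) (m : ℕ) (N : Finset V) (hN : x ^ (2 * m) ≤ #N) :
    #N ^ m ≤ x ^ (m * m) * #(G.stableTuples (Fin m) N) := by
  induction m generalizing N with
  | zero =>
    have : 0 < #(G.stableTuples (Fin 0) N) :=
      card_pos.2 ⟨fun i => i.elim0, mem_stableTuples.2 ⟨fun i => i.elim0, fun i => i.elim0⟩⟩
    simpa using this
  | succ m ih =>
    have hx1 : 1 ≤ x := by omega
    have hN2 : 2 * x ≤ #N := by
      calc 2 * x ≤ x * x := Nat.mul_le_mul_right _ hx2
        _ = x ^ 2 := by ring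
        _ ≤ x ^ (2 * (m + 1)) := Nat.pow_le_pow_right hx1 (by omega)
        _ ≤ #N := hN
    set D := N \ G.almostComplete x N with hD
    let R : V → Finset V := fun v => ({w ∈ N | ¬ G.Adj v w}).erase v
    have hDc : #N ≤ 2 * #D := by
      have h1 := hB.card_almostComplete_lt hx (by omega : x ≤ #N)
      have h2 := le_card_sdiff (G.almostComplete x N) N
      rw [← hD] at h2
      omega
    have hR : ∀ v ∈ D, #N ^ m ≤ x ^ (m * m + 2 * m) * #(G.stableTuples (Fin m) (R v)) := by
      intro v hv
      have h1 := le_mul_of_notMem_almostComplete (mem_sdiff.1 hv).2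
      have h2 := pred_card_le_card_erase (a := v) (s := {w ∈ N | ¬ G.Adj v w})
      change _ ≤ #(R v) at h2
      have h3 : #N ≤ x * (#(R v) + 1) := h1.trans (Nat.mul_le_mul_left _ (by omega))
      have h4 : #N ≤ x ^ 2 * #(R v) := by nlinarith
      have h5 : x ^ (2 * m) ≤ #(R v) := by
        refine Nat.le_of_mul_le_mul_left (c := x ^ 2) ?_ (by positivity)
        refine le_trans (le_of_eq ?_) (hN.trans h4)
        ring
      calc #N ^ m ≤ (x ^ 2 * #(R v)) ^ m := Nat.pow_le_pow_left h4 m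
        _ = x ^ (2 * m) * #(R v) ^ m := by ring
        _ ≤ x ^ (2 * m) * (x ^ (m * m) * #(G.stableTuples (Fin m) (R v))) :=
            Nat.mul_le_mul_left _ (ih _ h5)
        _ = _ := by ring
    have hinj : ∑ v ∈ D, #(G.stableTuples (Fin m) (R v)) ≤ #(G.stableTuples (Fin (m + 1)) N) := by
      rw [← card_sigma]
      refine card_le_card_of_injOn (fun p => Fin.cons p.1 p.2) ?_ ?_
      · rintro ⟨v, a⟩ hp
        simp only [coe_sigma, Set.mem_sigma_iff, mem_coe] at hp
        obtain ⟨hv, ha⟩ := hp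
        obtain ⟨ha, has⟩ := mem_stableTuples.1 ha
        have ha' : ∀ i, a i ∈ N ∧ a i ≠ v ∧ ¬ G.Adj v (a i) := by
          intro i
          have := ha i
          simp only [R, mem_erase, mem_filter] at this
          tauto
        rw [mem_coe, mem_stableTuples]
        refine ⟨Fin.cases (mem_sdiff.1 hv).1 fun i => (ha' i).1, ?_⟩
        intro i j
        refine Fin.cases ?_ (fun i => ?_) i <;> refine Fin.cases ?_ (fun j => ?_) j
        · simp
        · intro _
          simpa using ⟨(ha' j).2.1.symm, (ha' j).2.2⟩
        · intro _
          simpa [G.adj_comm] using (ha' i).2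
        · intro hij
          simpa using has i j (fun h => hij (h ▸ rfl))
      · rintro ⟨v, a⟩ _ ⟨w, b⟩ _ h
        obtain ⟨rfl, rfl⟩ := Fin.cons_inj.1 h
        rfl
    calc #N ^ (m + 1) = #N * #N ^ m := by ring
      _ ≤ 2 * #D * #N ^ m := Nat.mul_le_mul_right _ hDc
      _ = 2 * ∑ _v ∈ D, #N ^ m := by rw [sum_const, smul_eq_mul]; ring
      _ ≤ x * ∑ v ∈ D, x ^ (m * m + 2 * m) * #(G.stableTuples (Fin m) (R v)) :=
          Nat.mul_le_mul hx2 (sum_le_sum hR)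
      _ = x ^ (m * m + 2 * m + 1) * ∑ v ∈ D, #(G.stableTuples (Fin m) (R v)) := by
          rw [← mul_sum]; ring
      _ ≤ x ^ (m * m + 2 * m + 1) * #(G.stableTuples (Fin (m + 1)) N) :=
          Nat.mul_le_mul_left _ hinj
      _ = _ := by ring_nf

theorem BicliqueFree.pow_card_le_card_stableTuples (hB : G.BicliqueFree ℓ) (hx : 2 * ℓ ≤ x)
    (hx2 : 2 ≤ x) {ι : Type*} [Fintype ι] [DecidableEq ι] {m : ℕ} (hm : Fintype.card ι = m)
    {N : Finset V} (hN : x ^ (2 * m) ≤ #N) :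
    #N ^ m ≤ x ^ (m * m) * #(G.stableTuples ι N) := by
  refine (hB.pow_card_le_card_stableTuples_fin hx hx2 m N hN).trans
    (Nat.mul_le_mul_left _ ?_)
  let e : ι ≃ Fin m := Fintype.equivFinOfCardEq hm
  refine card_le_card_of_injOn (fun a i => a (e i)) ?_ ?_
  · intro a ha
    obtain ⟨ha, has⟩ := mem_stableTuples.1 (mem_coe.1 ha)
    exact mem_stableTuples.2 ⟨fun i => ha _, fun i j hij => has _ _ fun h => hij (e.injective h)⟩
  · intro a _ b _ h
    funext i
    simpa using congrFun h (e.symm i)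

/-- Counting tuples one of whose entries is determined up to `y` choices by the other entries. -/
theorem card_mul_card_le_of_update {ι : Type*} [Fintype ι] [DecidableEq ι] {N : Finset V}
    {s : Finset (ι → V)} (hs : s ⊆ Fintype.piFinset fun _ => N) (j : ι) (y : ℕ)
    (h : ∀ a ∈ s, #{v | Function.update a j v ∈ s} ≤ y) :
    #s * #N ≤ y * #N ^ Fintype.card ι := by
  let f : (ι → V) → ({i // i ≠ j} → V) := fun a i => a i
  have h1 : #s ≤ y * #(Fintype.piFinset fun _ : {i // i ≠ j} => N) := by
    refine card_le_mul_card_image_of_maps_to (f := f) ?_ y ?_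
    · intro a ha
      have := Fintype.mem_piFinset.1 (hs ha)
      exact Fintype.mem_piFinset.2 fun i => this i
    · intro b hb
      rcases ({a ∈ s | f a = b}).eq_empty_or_nonempty with h0 | ⟨a₀, ha₀⟩
      · simp [h0]
      · rw [mem_filter] at ha₀
        refine le_trans (card_le_card_of_injOn (fun a => a j) ?_ ?_) (h a₀ ha₀.1)
        · intro a ha
          rw [mem_coe, mem_filter] at ha ⊢
          refine ⟨mem_univ _, ?_⟩
          convert ha.1
          funext i
          by_cases hi : i = j
          · subst hi; simp
          · rw [Function.update_of_ne hi]
            exact congrFun (ha₀.2.trans ha.2.symm) ⟨i, hi⟩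
        · intro a ha a' ha' haa
          rw [mem_coe, mem_filter] at ha ha'
          funext i
          by_cases hi : i = j
          · subst hi; exact haa
          · exact congrFun (ha.2.trans ha'.2.symm) ⟨i, hi⟩
  have h2 : Fintype.card {i // i ≠ j} + 1 = Fintype.card ι := by
    have h3 : 1 ≤ Fintype.card ι := Fintype.card_pos_iff.2 ⟨j⟩
    rw [Fintype.card_subtype, filter_ne', card_erase_of_mem (mem_univ j), card_univ]
    omega
  calc #s * #N ≤ y * #(Fintype.piFinset fun _ : {i // i ≠ j} => N) * #N :=
        Nat.mul_le_mul_right _ h1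
    _ = y * #N ^ (Fintype.card {i // i ≠ j} + 1) := by
        rw [Fintype.card_piFinset, prod_const, card_univ]; ring
    _ = _ := by rw [h2]

theorem privateNbrs_insert {ι : Type*} [DecidableEq ι] (a : ι → V) (i i' j : ι) (J : Finset ι) :
    G.privateNbrs a i i' (insert j J) = {w ∈ G.privateNbrs a i i' J | ¬ G.Adj (a j) w} := by
  ext w
  simp only [privateNbrs, mem_filter, mem_univ, true_and, mem_insert, forall_eq_or_imp]
  tauto

open Classical in
/-- All but few tuples are generic. -/
theorem BicliqueFree.card_not_generic (hB : G.BicliqueFree ℓ) (hx : 2 * ℓ ≤ x)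
    {ι : Type*} [Fintype ι] [DecidableEq ι] {m : ℕ} (hm : Fintype.card ι = m)
    (hmx : m ^ 3 * 2 ^ m ≤ x) (N : Finset V) :
    #{a ∈ Fintype.piFinset fun _ : ι => N | ¬ G.IsGenericTuple x a} * #N ≤ x ^ 2 * #N ^ m := by
  let s : ι × ι × ι × Finset ι → Finset (ι → V) := fun p =>
    {a ∈ Fintype.piFinset fun _ => N | p.2.2.1 ≠ p.1 ∧ p.2.2.1 ≠ p.2.1 ∧ p.2.2.1 ∉ p.2.2.2 ∧
      x ≤ #(G.privateNbrs a p.1 p.2.1 p.2.2.2) ∧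
      a p.2.2.1 ∈ G.almostComplete x (G.privateNbrs a p.1 p.2.1 p.2.2.2)}
  have hsub : {a ∈ Fintype.piFinset fun _ : ι => N | ¬ G.IsGenericTuple x a} ⊆
      univ.biUnion s := by
    intro a ha
    rw [mem_filter, IsGenericTuple] at ha
    obtain ⟨ha, hg⟩ := ha
    push Not at hg
    obtain ⟨i, i', j, J, h1, h2, h3, h4, h5⟩ := hg
    refine mem_biUnion.2 ⟨(i, i', j, J), mem_univ _, mem_filter.2 ⟨ha, h1, h2, h3, h4, ?_⟩⟩
    rw [almostComplete, mem_filter]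
    rw [privateNbrs_insert] at h5
    exact ⟨mem_univ _, h5⟩
  have hs : ∀ p, #(s p) * #N ≤ x * #N ^ m := by
    rintro ⟨i, i', j, J⟩
    rw [← hm]
    refine card_mul_card_le_of_update (filter_subset _ _) j x fun a ha => ?_
    simp only [mem_filter] at ha
    obtain ⟨-, h1, h2, h3, h4, -⟩ := ha
    have h5 : ∀ v, G.privateNbrs (Function.update a j v) i i' J = G.privateNbrs a i i' J := by
      intro v
      ext w
      simp only [privateNbrs, mem_filter, mem_univ, true_and, Function.update_of_ne h1.symm,
        Function.update_of_ne h2.symm]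
      refine and_congr_right fun _ => forall₂_congr fun l hl => ?_
      rw [Function.update_of_ne (by rintro rfl; exact h3 hl)]
    have h6 : ({v | Function.update a j v ∈ s (i, i', j, J)} : Finset V) ⊆
        G.almostComplete x (G.privateNbrs a i i' J) := by
      intro v hv
      simp only [s, mem_filter, mem_univ, true_and, h5, Function.update_self] at hv
      exact hv.2.2.2.2.2
    have h7 := hB.card_almostComplete_lt hx h4
    exact (card_le_card h6).trans (by omega)
  calc _ ≤ #(univ.biUnion s) * #N := Nat.mul_le_mul_right _ (card_le_card hsub)
    _ ≤ (∑ p, #(s p)) * #N := Nat.mul_le_mul_right _ card_biUnion_le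
    _ = ∑ p, #(s p) * #N := by rw [sum_mul]
    _ ≤ ∑ _p : ι × ι × ι × Finset ι, x * #N ^ m := sum_le_sum fun p _ => hs p
    _ = m ^ 3 * 2 ^ m * (x * #N ^ m) := by
        rw [sum_const, smul_eq_mul, card_univ, Fintype.card_prod, Fintype.card_prod,
          Fintype.card_prod, Fintype.card_finset, hm]
        ring
    _ ≤ x * (x * #N ^ m) := Nat.mul_le_mul_right _ hmx
    _ = _ := by ring

theorem IsGenericTuple.pow_le_card_privateNbrs {ι : Type*} [DecidableEq ι] {a : ι → V}
    (ha : G.IsGenericTuple x a) (hx1 : 1 ≤ x) (i i' : ι) (J : Finset ι) (hi : i ∉ J) (hi' : i' ∉ J)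
    {s : ℕ} (hs : 1 ≤ s) (h : x ^ (#J + s) ≤ G.codeg (a i) (a i')) :
    x ^ s ≤ #(G.privateNbrs a i i' J) := by
  induction J using Finset.induction_on generalizing s with
  | empty => simpa [privateNbrs, codeg] using h
  | insert j J hj ih =>
    rw [mem_insert, not_or] at hi hi'
    rw [card_insert_of_notMem hj] at h
    have h1 := ih hi.2 hi'.2 (s := s + 1) (by omega) (by rwa [add_assoc, add_comm 1 s] at h)
    have h2 := ha i i' j J (Ne.symm hi.1) (Ne.symm hi'.1) hj
      ((Nat.le_self_pow (by omega) x).trans h1)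
    refine Nat.le_of_mul_le_mul_left (c := x) ?_ hx1
    rw [← pow_succ']
    exact h1.trans h2

end Generic

/-! ### Adjacent pairs and pairs of large codegree are sparse -/

/-- `G` has no `K_{ℓ,ℓ}` subgraph and no induced cycle of length at least `4 k`, and `x` exceeds `2
ℓ` and the constants depending on `k` that come up; all quantities will be compared with powers of
`x`. -/
structure IsTame {V : Type*} (G : SimpleGraph V) (ℓ x k : ℕ) : Prop where
  bicliqueFree : G.BicliqueFree ℓ
  two_mul_le : 2 * ℓ ≤ x
  two_le : 2 ≤ k
  const_le : (2 * k) ^ 3 * 2 ^ (2 * k) ≤ x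
  longInducedCycleFree : G.LongInducedCycleFree (4 * k)

/-- The codegree, as a power of `x`, from which on a pair of vertices counts as heavy. -/
def heavyExp (k : ℕ) : ℕ := 6 * k + 1

/-- The pair `u ≠ v` is adjacent or heavy. -/
def Crowded {V : Type*} [Fintype V] (G : SimpleGraph V) [DecidableRel G.Adj] (M : ℕ) (u v : V) :
    Prop :=
  u ≠ v ∧ (G.Adj u v ∨ M ≤ G.codeg u v)

section Sparse

variable {V : Type*} [Fintype V] [DecidableEq V] {G : SimpleGraph V} [DecidableRel G.Adj]
  {ℓ x k : ℕ}

theorem IsTame.le_x (h : G.IsTame ℓ x k) : (2 * k) ^ 2 ≤ x ∧ 2 ≤ x := by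
  have h1 := h.const_le
  have h2 := h.two_le
  have h3 : 1 ≤ 2 ^ (2 * k) := Nat.one_le_two_pow
  have h4 : (2 * k) ^ 2 ≤ (2 * k) ^ 3 := Nat.pow_le_pow_right (by omega) (by omega)
  have h5 : (2 * k) ^ 3 * 1 ≤ (2 * k) ^ 3 * 2 ^ (2 * k) := Nat.mul_le_mul_left _ h3
  have h6 : 4 ≤ (2 * k) ^ 2 := by nlinarith
  omega

/-- In a stable generic tuple of `2 k` vertices not all cross pairs are heavy: otherwise one could
choose private common neighbours of the consecutive pairs of a cyclic ordering, stable among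
themselves, and obtain an induced cycle of length `4 k`. -/
theorem IsTame.not_forall_heavy (h : G.IsTame ℓ x k) {a : Fin k ⊕ Fin k → V}
    (has : G.IsStableTuple a) (hag : G.IsGenericTuple x a)
    (hheavy : ∀ i j, x ^ heavyExp k ≤ G.codeg (a (Sum.inl i)) (a (Sum.inr j))) : False := by
  have hk := h.two_le
  obtain ⟨-, hx2⟩ := h.le_x
  have hk0 : 0 < k := by omega
  let idx : ℕ → Fin k ⊕ Fin k := fun n =>
    if n % 2 = 0 then Sum.inl ⟨n / 2 % k, Nat.mod_lt _ hk0⟩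
    else Sum.inr ⟨n / 2 % k, Nat.mod_lt _ hk0⟩
  have hidx : ∀ i j, i < 2 * k → j < 2 * k → idx i = idx j → i = j := by
    intro i j hi hj hij
    have hi' : i / 2 % k = i / 2 := Nat.mod_eq_of_lt (by omega)
    have hj' : j / 2 % k = j / 2 := Nat.mod_eq_of_lt (by omega)
    by_cases h1 : i % 2 = 0 <;> by_cases h2 : j % 2 = 0 <;>
      simp only [idx, h1, h2, if_true, if_false, reduceCtorEq, Sum.inl.injEq, Sum.inr.injEq,
        Fin.mk.injEq] at hij <;> omega
  let nx : ℕ → ℕ := fun n => if n + 1 = 2 * k then 0 else n + 1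
  have hnx : ∀ n, n < 2 * k → nx n < 2 * k := by
    intro n hn
    simp only [nx]
    split_ifs <;> omega
  have hcod : ∀ n, n < 2 * k → x ^ heavyExp k ≤ G.codeg (a (idx n)) (a (idx (nx n))) := by
    intro n hn
    by_cases h1 : n % 2 = 0
    · have h2 : nx n % 2 ≠ 0 := by simp only [nx]; split_ifs <;> omega
      simp only [idx, h1, h2, if_true, if_false]
      exact hheavy _ _
    · have h2 : nx n % 2 = 0 := by simp only [nx]; split_ifs <;> omega
      simp only [idx, h1, h2, if_true, if_false]
      rw [codeg_comm]
      exact hheavy _ _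
  let J : ℕ → Finset (Fin k ⊕ Fin k) := fun n => univ \ {idx n, idx (nx n)}
  let W : ℕ → Finset V := fun n => G.privateNbrs a (idx n) (idx (nx n)) (J n)
  have hW : ∀ n ∈ range (2 * k), x ^ (2 * #(range (2 * k)) + 1) ≤ #(W n) := by
    intro n hn
    rw [mem_range] at hn
    rw [card_range]
    refine hag.pow_le_card_privateNbrs (by omega) _ _ _ (by simp [J]) (by simp [J]) (by omega) ?_
    refine le_trans (Nat.pow_le_pow_right (by omega) ?_) (hcod n hn)
    have h1 : #(J n) ≤ 2 * k := (card_le_univ _).trans (by simp; omega)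
    unfold heavyExp
    omega
  have : Nonempty V := ⟨a (idx 0)⟩
  obtain ⟨b, hb, hbs⟩ := h.bicliqueFree.exists_stable_transversal h.two_mul_le hx2
    (range (2 * k)) W hW
  refine h.longInducedCycleFree (4 * k) (by omega) le_rfl ?_
  rw [show 4 * k = 2 * (2 * k) by ring]
  refine isIndContained_cycleGraph_of_subdivision (by omega) (fun n => a (idx n)) b ?_ ?_ ?_ ?_ ?_
  · intro i j hij hj
    exact (has _ _ fun he => by have := hidx _ _ (by omega) hj he; omega).1
  · intro i j hij hj
    exact (hbs i (mem_range.2 (by omega)) j (mem_range.2 hj) (by omega)).1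
  · intro i j hij hj
    exact (has _ _ fun he => by have := hidx _ _ (by omega) hj he; omega).2
  · intro i j hij hj
    exact (hbs i (mem_range.2 (by omega)) j (mem_range.2 hj) (by omega)).2
  · intro i j hi hj
    have hbi := hb i (mem_range.2 hi)
    simp only [W, privateNbrs, mem_filter, mem_univ, true_and, J, mem_sdiff, mem_insert,
      mem_singleton] at hbi
    obtain ⟨⟨h1, h2⟩, h3⟩ := hbi
    have hnx' : j = nx i ↔ j = i + 1 ∨ (i + 1 = 2 * k ∧ j = 0) := by
      simp only [nx]
      split_ifs <;> omega
    rw [← hnx']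
    constructor
    · intro hadj
      by_contra hcon
      push Not at hcon
      refine h3 (idx j) ?_ hadj.symm
      rintro (he | he)
      · exact hcon.1 (hidx _ _ hj hi he)
      · exact hcon.2 (hidx _ _ hj (hnx i hi) he)
    · rintro (rfl | rfl)
      · exact h1.symm
      · exact h2.symm

/-- A size, as a power of `x`, from which on sets span less than an `x ^ (-e)` fraction of all
possible edges. -/
def denseExp (k e : ℕ) : ℕ := (e + 1) * (2 * k + 1) + 2 * k * (2 * k) + heavyExp k + 2

/-- Sets of polynomial size are sparse. If `N` were dense, many vertices would have many neighbours
in `N`, hence many stable `2 k`-tuples among them; by double counting some stable generic tuple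
has a large common neighbourhood, so that all its pairs are heavy. -/
theorem IsTame.sum_adj_lt (h : G.IsTame ℓ x k) (e : ℕ) (N : Finset V)
    (hN : x ^ denseExp k e ≤ #N) :
    x ^ e * ∑ v ∈ N, #{w ∈ N | G.Adj v w} < #N ^ 2 := by
  classical
  by_contra hcon
  push Not at hcon
  obtain ⟨-, hx2⟩ := h.le_x
  have hk := h.two_le
  have hx1 : 1 ≤ x := by omega
  set m := 2 * k with hm
  set n := #N with hn
  have hn0 : 0 < n := lt_of_lt_of_le (by positivity) hN
  have hι : Fintype.card (Fin k ⊕ Fin k) = m := by simp; omega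
  let d : V → ℕ := fun v => #{w ∈ N | G.Adj v w}
  let S : V → Finset (Fin k ⊕ Fin k → V) := fun v =>
    G.stableTuples (Fin k ⊕ Fin k) {w ∈ N | G.Adj v w}
  set P := {v ∈ N | n ≤ x ^ (e + 1) * d v} with hP
  have hdn : ∀ v, d v ≤ n := fun v => card_filter_le _ _
  have hPn : n ≤ x ^ (e + 1) * #P := by
    have h1 : ∀ v ∈ N, x ^ (e + 1) * d v ≤
        n + if n ≤ x ^ (e + 1) * d v then x ^ (e + 1) * n else 0 := by
      intro v _
      split_ifs with hv
      · exact (Nat.mul_le_mul_left _ (hdn v)).trans (by omega)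
      · omega
    have h2 := sum_le_sum h1
    rw [sum_add_distrib, ← sum_filter, ← hP, sum_const, sum_const, ← mul_sum, smul_eq_mul,
      smul_eq_mul, ← hn] at h2
    have h3 : x * n ^ 2 ≤ x ^ (e + 1) * ∑ v ∈ N, d v := by
      rw [pow_succ' x e, mul_assoc]
      exact Nat.mul_le_mul_left _ hcon
    have h4 : 2 * n ^ 2 ≤ x * n ^ 2 := Nat.mul_le_mul_right _ hx2
    refine Nat.le_of_mul_le_mul_left (c := n) ?_ hn0
    nlinarith
  have hlow : n ^ m * n ≤ x ^ ((e + 1) * (m + 1) + m * m) * ∑ v ∈ N, #(S v) := by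
    have h1 : ∀ v ∈ P, n ^ m ≤ x ^ ((e + 1) * m + m * m) * #(S v) := by
      intro v hv
      have hv := (mem_filter.1 hv).2
      have h2 : x ^ (2 * m) ≤ d v := by
        refine Nat.le_of_mul_le_mul_left (c := x ^ (e + 1)) ?_ (by positivity)
        refine le_trans ?_ hv
        rw [← pow_add]
        refine le_trans (Nat.pow_le_pow_right hx1 ?_) hN
        unfold denseExp
        rw [← hm]
        nlinarith
      calc n ^ m ≤ (x ^ (e + 1) * d v) ^ m := Nat.pow_le_pow_left hv m
        _ = x ^ ((e + 1) * m) * d v ^ m := by rw [mul_pow, pow_mul x (e + 1) m]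
        _ ≤ x ^ ((e + 1) * m) * (x ^ (m * m) * #(S v)) := Nat.mul_le_mul_left _
            (h.bicliqueFree.pow_card_le_card_stableTuples h.two_mul_le hx2 hι h2)
        _ = _ := by rw [pow_add x ((e + 1) * m), mul_assoc (x ^ ((e + 1) * m))]
    calc n ^ m * n ≤ n ^ m * (x ^ (e + 1) * #P) := Nat.mul_le_mul_left _ hPn
      _ = x ^ (e + 1) * ∑ _v ∈ P, n ^ m := by rw [sum_const, smul_eq_mul]; ring
      _ ≤ x ^ (e + 1) * ∑ v ∈ P, x ^ ((e + 1) * m + m * m) * #(S v) :=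
          Nat.mul_le_mul_left _ (sum_le_sum h1)
      _ = x ^ ((e + 1) * (m + 1) + m * m) * ∑ v ∈ P, #(S v) := by
          rw [← mul_sum, ← mul_assoc, ← pow_add]; congr 2; ring
      _ ≤ _ := Nat.mul_le_mul_left _ (sum_le_sum_of_subset (filter_subset _ _))
  set T := Fintype.piFinset fun _ : Fin k ⊕ Fin k => N with hT
  have hTc : #T = n ^ m := by
    rw [hT, Fintype.card_piFinset, prod_const, card_univ, hι]
  have hup : ∑ v ∈ N, #(S v) ≤ n ^ m * x ^ heavyExp k + x ^ 2 * n ^ m := by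
    have h1 : ∀ v ∈ N, #(S v) = ∑ a ∈ T, if a ∈ S v then 1 else 0 := by
      intro v _
      rw [← card_filter]
      congr 1
      ext a
      rw [mem_filter]
      refine ⟨fun ha => ⟨?_, ha⟩, fun ha => ha.2⟩
      have := (mem_stableTuples.1 ha).1
      exact Fintype.mem_piFinset.2 fun i => (mem_filter.1 (this i)).1
    rw [sum_congr rfl h1, sum_comm]
    have h2 : ∀ a ∈ T, (∑ v ∈ N, if a ∈ S v then 1 else 0) ≤
        x ^ heavyExp k + if ¬ G.IsGenericTuple x a then n else 0 := by
      intro a ha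
      rw [← card_filter]
      by_cases hg : G.IsGenericTuple x a
      swap
      · rw [if_pos hg]
        exact (card_filter_le _ _).trans (Nat.le_add_left _ _)
      · rw [if_neg (not_not.2 hg), add_zero]
        by_contra hbig
        push Not at hbig
        have hcommon : ∀ i j, x ^ heavyExp k ≤ G.codeg (a i) (a j) := by
          intro i j
          refine hbig.le.trans (card_le_card fun v hv => ?_)
          have := (mem_stableTuples.1 (mem_filter.1 hv).2).1
          exact mem_filter.2 ⟨mem_univ _, (mem_filter.1 (this i)).2.symm,
            (mem_filter.1 (this j)).2.symm⟩
        obtain ⟨v, hv⟩ := card_pos.1 (lt_of_le_of_lt (Nat.zero_le _) hbig)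
        exact h.not_forall_heavy (mem_stableTuples.1 (mem_filter.1 hv).2).2 hg
          fun i j => hcommon _ _
    refine (sum_le_sum h2).trans ?_
    rw [sum_add_distrib, sum_const, hTc, smul_eq_mul, ← sum_filter, sum_const, smul_eq_mul]
    exact Nat.add_le_add_left
      (h.bicliqueFree.card_not_generic h.two_mul_le hι h.const_le N) _
  have h5 : n ≤ x ^ ((e + 1) * (m + 1) + m * m) * (x ^ heavyExp k + x ^ 2) := by
    refine Nat.le_of_mul_le_mul_left (c := n ^ m) ?_ (by positivity)
    refine hlow.trans ((Nat.mul_le_mul_left _ hup).trans (le_of_eq ?_))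
    ring
  have h6 : x ^ heavyExp k + x ^ 2 < x ^ (heavyExp k + 2) := by
    have h7 : x ^ 2 ≤ x ^ heavyExp k := Nat.pow_le_pow_right hx1 (by unfold heavyExp; omega)
    have h8 : 0 < x ^ heavyExp k := by positivity
    have h10 : 4 ≤ x ^ 2 := by nlinarith
    rw [pow_add]
    have := Nat.mul_le_mul_left (x ^ heavyExp k) h10
    omega
  have h9 : x ^ ((e + 1) * (m + 1) + m * m) * (x ^ heavyExp k + x ^ 2) < x ^ denseExp k e := by
    unfold denseExp
    rw [← hm, add_assoc _ (heavyExp k) 2, pow_add x _ (heavyExp k + 2)]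
    exact Nat.mul_lt_mul_of_pos_left h6 (by positivity)
  omega

/-- A dense relation contains many copies of `K_{k,k}`, by convexity. -/
theorem pow_card_le_card_homs (R : V → V → Prop) [DecidableRel R] (hk : 1 ≤ k) (e : ℕ)
    (N : Finset V) (hN : 0 < #N) (h : #N ^ 2 ≤ x ^ e * ∑ z ∈ N, #{y ∈ N | R z y}) :
    #N ^ (2 * k) ≤ x ^ (e * (k * k)) *
      ∑ y ∈ Fintype.piFinset fun _ : Fin k => N,
        #{z ∈ Fintype.piFinset fun _ : Fin k => N | ∀ j i, R (z j) (y i)} := by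
  set n := #N with hn
  set P := Fintype.piFinset fun _ : Fin k => N with hP
  obtain ⟨k', rfl⟩ : ∃ k', k = k' + 1 := ⟨k - 1, by omega⟩
  have hPc : #P = n ^ (k' + 1) := by simp [hP, hn]
  let s : (Fin (k' + 1) → V) → ℕ := fun y => #{z ∈ N | ∀ i, R z (y i)}
  have h1 : ∀ z, #{y ∈ N | R z y} ^ (k' + 1) = #{y ∈ P | ∀ i, R z (y i)} := by
    intro z
    rw [← Fintype.card_piFinset_const]
    congr 1
    ext y
    simp [hP, Fintype.mem_piFinset, forall_and]
  have h2 : ∀ y : Fin (k' + 1) → V, s y ^ (k' + 1) = #{z ∈ P | ∀ j i, R (z j) (y i)} := by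
    intro y
    rw [← Fintype.card_piFinset_const]
    congr 1
    ext z
    simp [hP, Fintype.mem_piFinset, forall_and]
  have h3 : ∑ z ∈ N, #{y ∈ N | R z y} ^ (k' + 1) = ∑ y ∈ P, s y := by
    rw [sum_congr rfl fun z _ => h1 z]
    simp only [s, card_filter]
    rw [sum_comm]
  have h4 : (∑ z ∈ N, #{y ∈ N | R z y}) ^ (k' + 1) ≤ n ^ k' * ∑ y ∈ P, s y := by
    rw [← h3]
    exact pow_sum_le_card_mul_sum_pow (fun _ _ => Nat.zero_le _) k'
  have h5 : (∑ y ∈ P, s y) ^ (k' + 1) ≤ (n ^ (k' + 1)) ^ k' *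
      ∑ y ∈ P, #{z ∈ P | ∀ j i, R (z j) (y i)} := by
    rw [← sum_congr rfl fun y _ => h2 y, ← hPc]
    exact pow_sum_le_card_mul_sum_pow (fun _ _ => Nat.zero_le _) k'
  refine Nat.le_of_mul_le_mul_left (c := n ^ (2 * k' * (k' + 1))) ?_ (by positivity)
  calc n ^ (2 * k' * (k' + 1)) * n ^ (2 * (k' + 1)) = ((n ^ 2) ^ (k' + 1)) ^ (k' + 1) := by
        rw [← pow_add, ← pow_mul, ← pow_mul]; ring_nf
    _ ≤ ((x ^ e * ∑ z ∈ N, #{y ∈ N | R z y}) ^ (k' + 1)) ^ (k' + 1) := by gcongr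
    _ = x ^ (e * ((k' + 1) * (k' + 1))) *
          ((∑ z ∈ N, #{y ∈ N | R z y}) ^ (k' + 1)) ^ (k' + 1) := by
        rw [mul_pow, mul_pow, ← pow_mul, ← pow_mul]
    _ ≤ x ^ (e * ((k' + 1) * (k' + 1))) * (n ^ k' * ∑ y ∈ P, s y) ^ (k' + 1) := by gcongr
    _ = x ^ (e * ((k' + 1) * (k' + 1))) * n ^ (k' * (k' + 1)) * (∑ y ∈ P, s y) ^ (k' + 1) := by
        rw [mul_pow, ← pow_mul, mul_assoc]
    _ ≤ x ^ (e * ((k' + 1) * (k' + 1))) * n ^ (k' * (k' + 1)) * ((n ^ (k' + 1)) ^ k' *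
          ∑ y ∈ P, #{z ∈ P | ∀ j i, R (z j) (y i)}) := by gcongr
    _ = _ := by
        rw [← pow_mul, show 2 * k' * (k' + 1) = k' * (k' + 1) + (k' + 1) * k' by ring, pow_add]
        ring

theorem card_filter_pair_mul_sq_le {ι : Type*} [Fintype ι] [DecidableEq ι] (R : V → V → Prop)
    [DecidableRel R] (N : Finset V) {i j : ι} (hij : i ≠ j) :
    #{a ∈ Fintype.piFinset fun _ : ι => N | R (a i) (a j)} * #N ^ 2 ≤
      (∑ u ∈ N, #{v ∈ N | R u v}) * #N ^ Fintype.card ι := by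
  have hcard : Fintype.card {l // l ≠ i ∧ l ≠ j} + 2 = Fintype.card ι := by
    have h1 : ({l | l ≠ i ∧ l ≠ j} : Finset ι) = univ \ {i, j} := by
      ext l; simp
    have h2 := card_sdiff_add_card_eq_card (subset_univ ({i, j} : Finset ι))
    rw [card_pair hij, card_univ] at h2
    rw [Fintype.card_subtype, h1, h2]
  let f : (ι → V) → (Σ _ : V, V) × ({l // l ≠ i ∧ l ≠ j} → V) :=
    fun a => (⟨a i, a j⟩, fun l => a l)
  have h1 : #{a ∈ Fintype.piFinset fun _ : ι => N | R (a i) (a j)} ≤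
      #((N.sigma fun u => {v ∈ N | R u v}) ×ˢ
        Fintype.piFinset fun _ : {l // l ≠ i ∧ l ≠ j} => N) := by
    refine card_le_card_of_injOn f ?_ ?_
    · intro a ha
      simp only [coe_filter, Fintype.mem_piFinset, Set.mem_ofPred_eq] at ha
      simp only [f, coe_product, Set.mem_prod, mem_coe, mem_sigma, mem_filter,
        Fintype.mem_piFinset]
      exact ⟨⟨ha.1 i, ha.1 j, ha.2⟩, fun l => ha.1 l⟩
    · intro a _ b _ hab
      simp only [f, Prod.mk.injEq, Sigma.mk.injEq, heq_eq_eq] at hab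
      funext l
      by_cases hi : l = i
      · rw [hi]; exact hab.1.1
      by_cases hj : l = j
      · rw [hj]; exact hab.1.2
      exact congrFun hab.2 ⟨l, hi, hj⟩
  rw [card_product, card_sigma, Fintype.card_piFinset, prod_const, card_univ] at h1
  calc _ ≤ (∑ u ∈ N, #{v ∈ N | R u v}) * #N ^ Fintype.card {l // l ≠ i ∧ l ≠ j} * #N ^ 2 :=
        Nat.mul_le_mul_right _ h1
    _ = _ := by rw [mul_assoc, ← pow_add, hcard]

/-- A size, as a power of `x`, from which on at most an `x ^ (-e)` fraction of the pairs in a set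
are crowded. -/
def crowdExp (k e : ℕ) : ℕ :=
  denseExp k (e + 1) + denseExp k ((e + 1) * (k * k) + 2) + (e + 1) * (k * k) + 7

theorem IsTame.sum_heavy_lt (h : G.IsTame ℓ x k) (e : ℕ) (N : Finset V)
    (hN : x ^ (denseExp k (e * (k * k) + 2) + e * (k * k) + 7) ≤ #N) :
    x ^ e * ∑ v ∈ N, #{w ∈ N | x ^ heavyExp k ≤ G.codeg v w} < #N ^ 2 := by
  classical
  by_contra hcon
  push Not at hcon
  obtain ⟨hmx, hx2⟩ := h.le_x
  have hk := h.two_le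
  have hx1 : 1 ≤ x := by omega
  set m := 2 * k with hm
  set E := e * (k * k) with hE
  set n := #N with hn
  have hn0 : 0 < n := lt_of_lt_of_le (by positivity) hN
  have hι : Fintype.card (Fin k ⊕ Fin k) = m := by simp; omega
  set T := Fintype.piFinset fun _ : Fin k ⊕ Fin k => N with hT
  set X := {a ∈ T | ∀ i j, x ^ heavyExp k ≤ G.codeg (a (Sum.inl i)) (a (Sum.inr j))} with hX
  have hlow : n ^ m ≤ x ^ E * #X := by
    refine (pow_card_le_card_homs (k := k) (fun u v => x ^ heavyExp k ≤ G.codeg u v) (by omega) e N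
      hn0 hcon).trans (Nat.mul_le_mul_left _ ?_)
    rw [← card_sigma]
    refine card_le_card_of_injOn (fun p => Sum.elim p.2 p.1) ?_ ?_
    · rintro ⟨y, z⟩ hp
      simp only [coe_sigma, Set.mem_sigma_iff, mem_coe, mem_filter, Fintype.mem_piFinset] at hp
      simp only [hX, hT, mem_coe, mem_filter, Fintype.mem_piFinset, Sum.forall, Sum.elim_inl,
        Sum.elim_inr]
      exact ⟨⟨hp.2.1, hp.1⟩, hp.2.2⟩
    · rintro ⟨y, z⟩ _ ⟨y', z'⟩ _ hp
      have h1 : z = z' := funext fun i => congrFun hp (Sum.inl i)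
      have h2 : y = y' := funext fun i => congrFun hp (Sum.inr i)
      rw [h1, h2]
  let F : (Fin k ⊕ Fin k) × (Fin k ⊕ Fin k) → Finset (Fin k ⊕ Fin k → V) := fun p =>
    {a ∈ T | p.1 ≠ p.2 ∧ (a p.1 = a p.2 ∨ G.Adj (a p.1) (a p.2))}
  have hXsub : X ⊆ {a ∈ T | ¬ G.IsGenericTuple x a} ∪ univ.biUnion F := by
    intro a ha
    rw [hX, mem_filter] at ha
    by_contra hcon2
    simp only [mem_union, mem_filter, mem_biUnion, mem_univ, true_and, F, not_or, not_and,
      not_not, not_exists, ha.1, Prod.forall] at hcon2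
    exact h.not_forall_heavy (fun i j hij => ⟨(hcon2.2 i j hij).1, (hcon2.2 i j hij).2⟩)
      hcon2.1 ha.2
  have hF : ∀ p, #(F p) * n ^ 2 * x ^ (E + 2) ≤ n ^ m * n * x ^ (E + 2) + n ^ m * n ^ 2 := by
    rintro ⟨i, j⟩
    by_cases hij : i = j
    · subst hij; simp [F]
    have h1 : F (i, j) ⊆ {a ∈ T | a i = a j} ∪ {a ∈ T | G.Adj (a i) (a j)} := by
      intro a ha
      simp only [F, mem_filter, mem_union] at ha ⊢
      tauto
    have h2 := (card_le_card h1).trans (card_union_le _ _)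
    have h3 : #{a ∈ T | a i = a j} * n ≤ 1 * n ^ m := by
      rw [← hι]
      refine card_mul_card_le_of_update (filter_subset _ _) i 1 fun a _ => ?_
      rw [card_le_one]
      intro u hu v hv
      simp only [mem_filter, mem_univ, true_and, Function.update_self,
        Function.update_of_ne (Ne.symm hij)] at hu hv
      rw [hu.2, hv.2]
    have h4 := card_filter_pair_mul_sq_le (fun u v => G.Adj u v) N hij
    rw [hι] at h4
    have h5 := (h.sum_adj_lt (E + 2) N
      ((Nat.pow_le_pow_right hx1 (by omega)).trans hN)).le
    calc #(F (i, j)) * n ^ 2 * x ^ (E + 2)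
        ≤ (#{a ∈ T | a i = a j} + #{a ∈ T | G.Adj (a i) (a j)}) * n ^ 2 * x ^ (E + 2) := by gcongr
      _ = (#{a ∈ T | a i = a j} * n) * n * x ^ (E + 2) +
          (#{a ∈ T | G.Adj (a i) (a j)} * n ^ 2) * x ^ (E + 2) := by ring
      _ ≤ (1 * n ^ m) * n * x ^ (E + 2) +
          ((∑ u ∈ N, #{v ∈ N | G.Adj u v}) * n ^ m) * x ^ (E + 2) := by gcongr
      _ = n ^ m * n * x ^ (E + 2) +
          n ^ m * (x ^ (E + 2) * ∑ u ∈ N, #{v ∈ N | G.Adj u v}) := by ring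
      _ ≤ n ^ m * n * x ^ (E + 2) + n ^ m * n ^ 2 := by gcongr
  have hup : #X * n ^ 2 * x ^ (E + 2) ≤
      (x ^ 2 + x) * n ^ m * n * x ^ (E + 2) + x * n ^ m * n ^ 2 := by
    have h1 := (card_le_card hXsub).trans ((card_union_le _ _).trans
      (Nat.add_le_add_left card_biUnion_le _))
    have h2 := h.bicliqueFree.card_not_generic h.two_mul_le hι h.const_le N
    have h3 : (∑ p, #(F p)) * n ^ 2 * x ^ (E + 2) ≤
        x * (n ^ m * n * x ^ (E + 2) + n ^ m * n ^ 2) := by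
      rw [sum_mul, sum_mul]
      refine (sum_le_sum fun p _ => hF p).trans ?_
      rw [sum_const, card_univ, Fintype.card_prod, hι, smul_eq_mul]
      refine Nat.mul_le_mul_right _ (le_trans (le_of_eq ?_) hmx)
      ring
    calc #X * n ^ 2 * x ^ (E + 2)
        ≤ (#{a ∈ T | ¬ G.IsGenericTuple x a} + ∑ p, #(F p)) * n ^ 2 * x ^ (E + 2) := by gcongr
      _ = (#{a ∈ T | ¬ G.IsGenericTuple x a} * n) * n * x ^ (E + 2) +
          (∑ p, #(F p)) * n ^ 2 * x ^ (E + 2) := by ring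
      _ ≤ (x ^ 2 * n ^ m) * n * x ^ (E + 2) +
          x * (n ^ m * n * x ^ (E + 2) + n ^ m * n ^ 2) :=
        Nat.add_le_add (Nat.mul_le_mul_right _ (Nat.mul_le_mul_right _ h2)) h3
      _ = _ := by ring
  -- combining the two bounds, `n` is at most `x ^ (E + 5)`
  have h6 : n * x ^ 2 ≤ x ^ (E + 2) * (x ^ 2 + x) + n * x := by
    refine Nat.le_of_mul_le_mul_left (c := n ^ m * n * x ^ E) ?_ (by positivity)
    calc n ^ m * n * x ^ E * (n * x ^ 2) = n ^ m * (n ^ 2 * x ^ (E + 2)) := by ring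
      _ ≤ x ^ E * #X * (n ^ 2 * x ^ (E + 2)) := by gcongr
      _ = x ^ E * (#X * n ^ 2 * x ^ (E + 2)) := by ring
      _ ≤ x ^ E * ((x ^ 2 + x) * n ^ m * n * x ^ (E + 2) + x * n ^ m * n ^ 2) := by gcongr
      _ = _ := by ring
  have h7 : x ^ (E + 7) ≤ n := (Nat.pow_le_pow_right hx1 (by omega)).trans hN
  have h8 : n ≤ x ^ (E + 2) * (x ^ 2 + x) := by
    have h81 : x + x ≤ x ^ 2 := by nlinarith
    have h82 := Nat.mul_le_mul_left n h81
    have h83 := Nat.le_mul_of_pos_right n hx1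
    rw [mul_add] at h82
    omega
  have h9 : x ^ (E + 2) * (x ^ 2 + x) < x ^ (E + 7) := by
    rw [show E + 7 = E + 2 + 5 by ring, pow_add x (E + 2) 5]
    refine Nat.mul_lt_mul_of_pos_left ?_ (by positivity)
    have h10 : x ≤ x ^ 2 := Nat.le_self_pow (by omega) x
    have h11 : 0 < x ^ 2 := by positivity
    nlinarith [Nat.pow_le_pow_left hx2 3, pow_add x 2 3]
  omega

open Classical in
/-- In sets of polynomial size, crowded pairs are sparse. For heavy pairs this holds because a dense
relation contains many copies of `K_{k,k}`, most of which are generic and, as adjacent pairs are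
sparse, stable. -/
theorem IsTame.sum_crowded_le (h : G.IsTame ℓ x k) (e : ℕ) (N : Finset V)
    (hN : x ^ crowdExp k e ≤ #N) :
    x ^ e * ∑ v ∈ N, #{w ∈ N | G.Crowded (x ^ heavyExp k) v w} ≤ #N ^ 2 := by
  obtain ⟨-, hx2⟩ := h.le_x
  have hx1 : 1 ≤ x := by omega
  have h1 := h.sum_adj_lt (e + 1) N
    ((Nat.pow_le_pow_right hx1 (by unfold crowdExp; omega)).trans hN)
  have h2 := h.sum_heavy_lt (e + 1) N
    ((Nat.pow_le_pow_right hx1 (by unfold crowdExp; omega)).trans hN)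
  have h3 : ∑ v ∈ N, #{w ∈ N | G.Crowded (x ^ heavyExp k) v w} ≤
      ∑ v ∈ N, #{w ∈ N | G.Adj v w} + ∑ v ∈ N, #{w ∈ N | x ^ heavyExp k ≤ G.codeg v w} := by
    rw [← sum_add_distrib]
    refine sum_le_sum fun v _ => ?_
    refine le_trans (card_le_card fun w hw => ?_) (card_union_le _ _)
    obtain ⟨hw, -, hvw⟩ := mem_filter.1 hw
    rw [mem_union, mem_filter, mem_filter]
    exact hvw.imp (fun h => ⟨hw, h⟩) fun h => ⟨hw, h⟩
  refine Nat.le_of_mul_le_mul_left (c := 2) ?_ (by omega)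
  calc 2 * (x ^ e * ∑ v ∈ N, #{w ∈ N | G.Crowded (x ^ heavyExp k) v w})
      ≤ x * (x ^ e * (∑ v ∈ N, #{w ∈ N | G.Adj v w} +
          ∑ v ∈ N, #{w ∈ N | x ^ heavyExp k ≤ G.codeg v w})) := by gcongr
    _ = x ^ (e + 1) * ∑ v ∈ N, #{w ∈ N | G.Adj v w} +
          x ^ (e + 1) * ∑ v ∈ N, #{w ∈ N | x ^ heavyExp k ≤ G.codeg v w} := by ring
    _ ≤ 2 * #N ^ 2 := by omega

end Sparse

/-! ### Random induced subgraphs -/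

section Sampling

variable {V : Type*} [Fintype V] [DecidableEq V] {q : ℕ} [NeZero q]

/-- The vertices coloured `0` by `ω : V → Fin q`; for uniformly random `ω` this is a random set
containing each vertex independently with probability `1 / q`. -/
def sample (ω : V → Fin q) : Finset V := {v | ω v = 0}

theorem mem_sample {ω : V → Fin q} {v : V} : v ∈ sample ω ↔ ω v = 0 := by
  simp [sample]

theorem card_subset_sample (T : Finset V) :
    #{ω : V → Fin q | T ⊆ sample ω} * q ^ #T = q ^ Fintype.card V := by
  have h1 : ({ω : V → Fin q | T ⊆ sample ω} : Finset _) =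
      Fintype.piFinset fun v => if v ∈ T then {0} else univ := by
    ext ω
    simp only [mem_filter, mem_univ, true_and, Fintype.mem_piFinset, subset_iff, mem_sample]
    refine forall_congr' fun v => ?_
    split_ifs with hv <;> simp [hv]
  have h2 : ∀ v : V, #(if v ∈ T then ({0} : Finset (Fin q)) else univ) =
      if v ∈ T then 1 else q := by
    intro v
    split_ifs <;> simp
  rw [h1, Fintype.card_piFinset]
  simp only [h2]
  rw [prod_ite, prod_const_one, one_mul, prod_const, ← pow_add]
  congr 1
  have := card_filter_add_card_filter_not (s := (univ : Finset V)) (fun v => v ∈ T)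
  rw [filter_univ_mem, card_univ] at this
  omega

/-- Two given vertices are sampled, and none of at most `q / 2` further ones, with probability at
least `1 / (2 q ^ 2)`. -/
theorem le_card_pair_sampled {u v : V} (huv : u ≠ v) {F : Finset V} (hu : u ∉ F) (hv : v ∉ F)
    (hF : 2 * #F ≤ q) :
    q ^ Fintype.card V ≤
      2 * q ^ 2 * #{ω : V → Fin q | (ω u = 0 ∧ ω v = 0) ∧ ∀ f ∈ F, ω f ≠ 0} := by
  set Q := q ^ Fintype.card V
  have hq : 0 < q := Nat.pos_of_ne_zero (NeZero.ne q)
  have h1 : ({ω : V → Fin q | {u, v} ⊆ sample ω} : Finset _) ⊆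
      ({ω | (ω u = 0 ∧ ω v = 0) ∧ ∀ f ∈ F, ω f ≠ 0} : Finset (V → Fin q)) ∪
        F.biUnion fun f => {ω | {f, u, v} ⊆ sample ω} := by
    intro ω hω
    simp only [mem_filter, mem_univ, true_and, insert_subset_iff, singleton_subset_iff,
      mem_sample, mem_union, mem_biUnion] at hω ⊢
    by_cases h : ∀ f ∈ F, ω f ≠ 0
    · exact Or.inl ⟨hω, h⟩
    · push Not at h
      obtain ⟨f, hf, hf0⟩ := h
      exact Or.inr ⟨f, hf, hf0, hω⟩
  have h2 := (card_le_card h1).trans ((card_union_le _ _).trans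
    (Nat.add_le_add_left card_biUnion_le _))
  have h3 := card_subset_sample (q := q) {u, v}
  rw [card_pair huv] at h3
  have h4 : (∑ f ∈ F, #{ω : V → Fin q | {f, u, v} ⊆ sample ω}) * q ^ 3 = #F * Q := by
    rw [sum_mul, ← smul_eq_mul (#F), ← sum_const]
    refine sum_congr rfl fun f hf => ?_
    have h5 := card_subset_sample (q := q) {f, u, v}
    rwa [card_eq_three.2 ⟨f, u, v, fun h => hu (h ▸ hf), fun h => hv (h ▸ hf), huv, rfl⟩] at h5
  have h5 := Nat.mul_le_mul_right (q ^ 3) h2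
  rw [add_mul, h4, pow_succ q 2, ← mul_assoc, h3, ← mul_assoc] at h5
  have h6 : 2 * (#F * Q) ≤ q * Q := by
    rw [← mul_assoc]
    exact Nat.mul_le_mul_right _ hF
  refine Nat.le_of_mul_le_mul_left (c := q) ?_ hq
  set g := #{ω : V → Fin q | (ω u = 0 ∧ ω v = 0) ∧ ∀ f ∈ F, ω f ≠ 0}
  change Q * q ≤ g * q ^ 2 * q + #F * Q at h5
  have h7 : q * (2 * q ^ 2 * g) = 2 * (g * q ^ 2 * q) := by ring
  rw [h7]
  have h8 : Q * q = q * Q := mul_comm _ _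
  omega

theorem sum_card_inter_sample (A : Finset V) :
    (∑ ω : V → Fin q, #{a ∈ A | ω a = 0}) * q = #A * q ^ Fintype.card V := by
  simp only [card_filter]
  rw [sum_comm, sum_mul, ← smul_eq_mul (#A), ← sum_const]
  refine sum_congr rfl fun a _ => ?_
  have := card_subset_sample (q := q) {a}
  rw [card_singleton, pow_one] at this
  rw [← this, ← card_filter]
  simp [mem_sample]

end Sampling

/-! ### Unbalanced pairs of sets -/

section Unbalanced

variable {V : Type*} [Fintype V] [DecidableEq V] {G : SimpleGraph V} [DecidableRel G.Adj] {k : ℕ}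

/-- The graph on `A` whose edges are the pairs that are the trace on `A` of a vertex of `B`, and
have codegree less than `M`. -/
def traceGraph (G : SimpleGraph V) [DecidableRel G.Adj] (A B : Finset V) (M : ℕ) :
    SimpleGraph V where
  Adj u v := u ≠ v ∧ G.codeg u v < M ∧ ∃ b ∈ B, {a ∈ A | G.Adj b a} = {u, v}
  symm.symm := by
    rintro u v ⟨h1, h2, b, hb, hab⟩
    exact ⟨h1.symm, by rwa [codeg_comm], b, hb, by rw [hab, pair_comm]⟩
  loopless.irrefl := fun u h => h.1 rfl

open Classical in
/-- If `A` and `B` are stable, then cycles of the trace graph become induced cycles of `G` of twice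
the length, so the trace graph is sparse. -/
theorem sum_traceGraph_le (hG : G.LongInducedCycleFree (4 * k)) (hk : 1 ≤ k) {A B : Finset V}
    (M : ℕ) (hA : ∀ u ∈ A, ∀ v ∈ A, ¬ G.Adj u v) (hB : ∀ u ∈ B, ∀ v ∈ B, ¬ G.Adj u v) :
    ∑ u ∈ A, #{v ∈ A | (G.traceGraph A B M).Adj u v} ≤ 4 * k * #A := by
  by_contra hcon
  push Not at hcon
  obtain ⟨A', hA', hne, hdeg⟩ := exists_minDegree_of_sum (m := 2 * k) (G.traceGraph A B M) A
    (by rw [← mul_assoc]; exact hcon)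
  obtain ⟨L, c, hL, hc⟩ := exists_isCyclicSeq_of_minDegree _ hne (by omega) hdeg
  have hL3 := hc.three_le
  let nx : ℕ → ℕ := fun n => if n + 1 = L then 0 else n + 1
  have hnx : ∀ i, i < L → nx i < L := by
    intro i hi; simp only [nx]; split_ifs <;> omega
  have hedge : ∀ i, i < L → (G.traceGraph A B M).Adj (c i) (c (nx i)) := by
    intro i hi
    simp only [nx]
    split_ifs with h
    · have := hc.close
      rwa [show L - 1 = i by omega] at this
    · exact hc.adj i (by omega)
  have hex : ∀ i, ∃ b, i < L → b ∈ B ∧ {a ∈ A | G.Adj b a} = {c i, c (nx i)} := by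
    intro i
    by_cases hi : i < L
    · obtain ⟨-, -, b, hb, h⟩ := hedge i hi
      exact ⟨b, fun _ => ⟨hb, h⟩⟩
    · exact ⟨c 0, fun h => absurd h hi⟩
  choose b hb using hex
  have hmem : ∀ i, i < L → c i ∈ A := fun i hi => hA' (hc.mem i hi)
  have hadj : ∀ i j, i < L → j < L → (G.Adj (b i) (c j) ↔ j = i ∨ j = nx i) := by
    intro i j hi hj
    have h1 : c j ∈ ({a ∈ A | G.Adj (b i) a} : Finset V) ↔ c j ∈ ({c i, c (nx i)} : Finset V) := by
      rw [(hb i hi).2]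
    simp only [mem_filter, hmem j hj, true_and, mem_insert, mem_singleton] at h1
    rw [h1]
    constructor
    · rintro (h | h)
      · exact Or.inl (hc.inj _ hj _ hi h)
      · exact Or.inr (hc.inj _ hj _ (hnx i hi) h)
    · rintro (rfl | rfl)
      · exact Or.inl rfl
      · exact Or.inr rfl
  refine hG (2 * L) (by omega) (by omega) ?_
  refine isIndContained_cycleGraph_of_subdivision hL3 c b ?_ ?_ ?_ ?_ ?_
  · intro i j hij hj he
    exact absurd (hc.inj i (by omega) j hj he) (by omega)
  · intro i j hij hj he
    -- `b i = b j` would see both `c i, c (i + 1)` and `c j, c (j + 1)`, but `L ≥ 3`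
    have h1 := (hadj i j (by omega) hj).1 (by rw [he]; exact (hadj j j hj hj).2 (Or.inl rfl))
    have h2 := (hadj j i hj (by omega)).1
      (by rw [← he]; exact (hadj i i (by omega) (by omega)).2 (Or.inl rfl))
    simp only [nx] at h1 h2
    split_ifs at h1 h2 <;> omega
  · intro i j hij hj
    exact hA _ (hmem _ (by omega)) _ (hmem _ hj)
  · intro i j hij hj
    exact hB _ (hb i (by omega)).1 _ (hb j hj).1
  · intro i j hi hj
    rw [hadj i j hi hj]
    simp only [nx]
    split_ifs <;> omega

open Classical in
/-- Let `B` be stable, let the edges inside `A` be oriented with out-degrees at most `d`, and let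
each vertex of `B` have at most `y` neighbours in `A`, among which there are at least `z` light
nonadjacent ordered pairs. Sampling `A` with probability `1 / q`, and keeping only the vertices none
of whose out-neighbours were sampled, makes each of these pairs a trace with probability about
`1 / q ^ 2`. As the trace graph is sparse, `B` cannot be much larger than `A`. -/
theorem card_mul_le_of_light_pairs (hG : G.LongInducedCycleFree (4 * k)) (hk : 1 ≤ k)
    {A B : Finset V} {O : V → Finset V} {d y z q M : ℕ}
    (hB : ∀ u ∈ B, ∀ v ∈ B, ¬ G.Adj u v)
    (hO : ∀ u ∈ A, ∀ v ∈ A, G.Adj u v → v ∈ O u ∨ u ∈ O v) (hOd : ∀ u, #(O u) ≤ d)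
    (hy : ∀ b ∈ B, #{a ∈ A | G.Adj b a} ≤ y)
    (hz : ∀ b ∈ B, z ≤
      ∑ u ∈ A with G.Adj b u, #{v ∈ A | G.Adj b v ∧ u ≠ v ∧ ¬ G.Crowded M u v})
    (hq : 2 * (2 * d + y) ≤ q) (hq0 : 0 < q) :
    #B * z ≤ 8 * k * M * q * #A := by
  have : NeZero q := ⟨hq0.ne'⟩
  set Q := q ^ Fintype.card V with hQ
  have hQ0 : 0 < Q := by positivity
  let Aω : (V → Fin q) → Finset V := fun ω =>
    {a ∈ A | ω a = 0 ∧ ∀ w ∈ O a, G.Adj a w → ω w ≠ 0}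
  have hAω : ∀ ω, ∀ u ∈ Aω ω, ∀ v ∈ Aω ω, ¬ G.Adj u v := by
    intro ω u hu v hv huv
    simp only [Aω, mem_filter] at hu hv
    rcases hO u hu.1 v hv.1 huv with h | h
    · exact hu.2.2 v h huv hv.2.1
    · exact hv.2.2 u h huv.symm hu.2.1
  -- triples `(b, u, v)` such that `{u, v}` is a light nonadjacent pair of neighbours of `b`
  let X : Finset (Σ _ : V, Σ _ : V, V) := B.sigma fun b =>
    ({u ∈ A | G.Adj b u} : Finset V).sigma fun u =>
      {v ∈ A | G.Adj b v ∧ u ≠ v ∧ ¬ G.Crowded M u v}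
  let E : (V → Fin q) → (Σ _ : V, Σ _ : V, V) → Prop := fun ω p =>
    p.2.1 ∈ Aω ω ∧ p.2.2 ∈ Aω ω ∧ {a ∈ Aω ω | G.Adj p.1 a} = {p.2.1, p.2.2}
  have hX : #B * z ≤ #X := by
    rw [card_sigma, ← smul_eq_mul, ← sum_const]
    refine sum_le_sum fun b hb => ?_
    rw [card_sigma]
    exact hz b hb
  have hprob : ∀ p ∈ X, Q ≤ 2 * q ^ 2 * #{ω | E ω p} := by
    rintro ⟨b, u, v⟩ hp
    simp only [X, mem_sigma, mem_filter] at hp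
    obtain ⟨hb, ⟨huA, hbu⟩, hvA, hbv, huv, hcr⟩ := hp
    have huv' : ¬ G.Adj u v := fun h => hcr ⟨huv, Or.inl h⟩
    let F : Finset V := {w ∈ O u | G.Adj u w} ∪ {w ∈ O v | G.Adj v w} ∪
      ({a ∈ A | G.Adj b a} \ {u, v})
    have hF : #F ≤ 2 * d + y := by
      have h1 : #{w ∈ O u | G.Adj u w} ≤ d := (card_filter_le _ _).trans (hOd u)
      have h2 : #{w ∈ O v | G.Adj v w} ≤ d := (card_filter_le _ _).trans (hOd v)
      have h3 : #({a ∈ A | G.Adj b a} \ {u, v}) ≤ y := (card_le_card sdiff_subset).trans (hy b hb)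
      have h4 := card_union_le ({w ∈ O u | G.Adj u w} ∪ {w ∈ O v | G.Adj v w})
        ({a ∈ A | G.Adj b a} \ {u, v})
      have h5 := card_union_le ({w ∈ O u | G.Adj u w}) {w ∈ O v | G.Adj v w}
      exact h4.trans (by omega)
    have hu : u ∉ F := by
      simp only [F, mem_union, mem_filter, mem_sdiff, mem_insert, true_or, not_true, and_false,
        or_false, G.irrefl, false_or, not_and]
      exact fun _ h => huv' h.symm
    have hv : v ∉ F := by
      simp only [F, mem_union, mem_filter, mem_sdiff, mem_insert, mem_singleton, or_true, not_true,
        and_false, or_false, G.irrefl, not_and]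
      exact fun _ h => huv' h
    refine (le_card_pair_sampled huv hu hv (by omega)).trans (Nat.mul_le_mul_left _
      (card_le_card fun ω hω => ?_))
    simp only [mem_filter, mem_univ, true_and] at hω ⊢
    obtain ⟨⟨hu0, hv0⟩, hF0⟩ := hω
    have huω : u ∈ Aω ω := by
      refine mem_filter.2 ⟨huA, hu0, fun w hw hadj => hF0 w ?_⟩
      simp only [F, mem_union, mem_filter]
      exact Or.inl (Or.inl ⟨hw, hadj⟩)
    have hvω : v ∈ Aω ω := by
      refine mem_filter.2 ⟨hvA, hv0, fun w hw hadj => hF0 w ?_⟩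
      simp only [F, mem_union, mem_filter]
      exact Or.inl (Or.inr ⟨hw, hadj⟩)
    refine ⟨huω, hvω, ?_⟩
    ext a
    simp only [mem_filter, mem_insert, mem_singleton]
    constructor
    · rintro ⟨ha, hba⟩
      by_contra hne
      simp only [Aω, mem_filter] at ha
      refine hF0 a ?_ ha.2.1
      simp only [F, mem_union, mem_filter, mem_sdiff, mem_insert, mem_singleton]
      exact Or.inr ⟨⟨ha.1, hba⟩, hne⟩
    · rintro (rfl | rfl)
      · exact ⟨huω, hbu⟩
      · exact ⟨hvω, hbv⟩
  have hcount : ∀ ω, #{p ∈ X | E ω p} ≤ 4 * k * M * #{a ∈ A | ω a = 0} := by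
    intro ω
    have h1 : #{p ∈ X | E ω p} ≤
        M * ∑ u ∈ Aω ω, #{v ∈ Aω ω | (G.traceGraph (Aω ω) B M).Adj u v} := by
      rw [← card_sigma]
      refine card_le_mul_card_image_of_maps_to (f := fun p => p.2) ?_ M ?_
      · rintro ⟨b, u, v⟩ hp
        simp only [X, E, mem_filter, mem_sigma] at hp
        obtain ⟨⟨hb, ⟨huA, hbu⟩, hvA, hbv, huv, hcr⟩, huω, hvω, htr⟩ := hp
        simp only [mem_sigma, mem_filter]
        refine ⟨huω, hvω, huv, ?_, b, hb, htr⟩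
        by_contra hM
        exact hcr ⟨huv, Or.inr (by omega)⟩
      · rintro ⟨u, v⟩ huv
        simp only [mem_sigma, mem_filter] at huv
        refine le_trans (card_le_card_of_injOn (t := {w | G.Adj u w ∧ G.Adj v w})
          (fun p => p.1) ?_ ?_) huv.2.2.2.1.le
        · rintro ⟨b, u', v'⟩ hp
          simp only [X, coe_filter, Set.mem_ofPred_eq, mem_sigma, mem_filter, Sigma.mk.injEq,
            heq_eq_eq] at hp
          obtain ⟨⟨⟨hb, ⟨huA, hbu⟩, hvA, hbv, -⟩, -⟩, rfl, rfl⟩ := hp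
          simp only [coe_filter, Set.mem_ofPred_eq, mem_univ, true_and]
          exact ⟨hbu.symm, hbv.symm⟩
        · rintro ⟨b, p⟩ hp ⟨b', p'⟩ hp' hbb
          simp only [mem_coe, mem_filter] at hp hp'
          obtain rfl : b = b' := hbb
          rw [hp.2, hp'.2]
    have h2 := sum_traceGraph_le hG hk M (hAω ω) hB
    have h3 : #(Aω ω) ≤ #{a ∈ A | ω a = 0} := by
      refine card_le_card fun a ha => ?_
      simp only [Aω, mem_filter] at ha ⊢
      exact ⟨ha.1, ha.2.1⟩
    calc _ ≤ M * (4 * k * #{a ∈ A | ω a = 0}) :=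
          h1.trans (Nat.mul_le_mul_left _ (h2.trans (Nat.mul_le_mul_left _ h3)))
      _ = _ := by ring
  have hswap : ∑ p ∈ X, #{ω | E ω p} = ∑ ω, #{p ∈ X | E ω p} := by
    simp only [card_filter]
    rw [sum_comm]
  refine Nat.le_of_mul_le_mul_left (c := Q) ?_ hQ0
  calc Q * (#B * z) ≤ Q * #X := Nat.mul_le_mul_left _ hX
    _ = ∑ _p ∈ X, Q := by rw [sum_const, smul_eq_mul, mul_comm]
    _ ≤ ∑ p ∈ X, 2 * q ^ 2 * #{ω | E ω p} := sum_le_sum hprob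
    _ = 2 * q ^ 2 * ∑ ω, #{p ∈ X | E ω p} := by rw [← mul_sum, hswap]
    _ ≤ 2 * q ^ 2 * ∑ ω : V → Fin q, 4 * k * M * #{a ∈ A | ω a = 0} :=
        Nat.mul_le_mul_left _ (sum_le_sum fun ω _ => hcount ω)
    _ = 8 * k * M * q * ((∑ ω : V → Fin q, #{a ∈ A | ω a = 0}) * q) := by
        rw [← mul_sum]; ring
    _ = Q * (8 * k * M * q * #A) := by rw [sum_card_inter_sample]; ring

end Unbalanced

/-! ### Almost regular sets -/

section Regular

variable {V : Type*} [Fintype V] [DecidableEq V] {G : SimpleGraph V} [DecidableRel G.Adj] {k : ℕ}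

/-- Expected number of sampled edges at the roots `r o` of those configurations `T o` all of whose
vertices are sampled. -/
theorem sum_degree_sampled_le {q : ℕ} [NeZero q] {A : Finset V} {Δ j : ℕ} {κ : Type*}
    (Ω : Finset κ) (T : κ → Finset V) (r : κ → V) (hT : ∀ o ∈ Ω, #(T o) = j)
    (hΔ : ∀ o ∈ Ω, #{w ∈ A | G.Adj (r o) w} ≤ Δ * q) :
    (∑ ω : V → Fin q, ∑ o ∈ Ω with T o ⊆ sample ω, #{w ∈ A | ω w = 0 ∧ G.Adj (r o) w}) * q ^ j ≤
      #Ω * (j + Δ) * q ^ Fintype.card V := by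
  set Q := q ^ Fintype.card V with hQ
  have hq : 0 < q := Nat.pos_of_ne_zero (NeZero.ne q)
  have h1 : ∀ o ∈ Ω, (∑ w ∈ A with G.Adj (r o) w, #{ω : V → Fin q | T o ⊆ sample ω ∧ ω w = 0}) *
      q ^ j ≤ (j + Δ) * Q := by
    intro o ho
    have h2 : ∀ w ∈ ({w ∈ A | G.Adj (r o) w} : Finset V),
        #{ω : V → Fin q | T o ⊆ sample ω ∧ ω w = 0} * q ^ (j + 1) ≤
          Q + if w ∈ T o then q * Q else 0 := by
      intro w _
      have h3 : ({ω : V → Fin q | T o ⊆ sample ω ∧ ω w = 0} : Finset _) =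
          ({ω | insert w (T o) ⊆ sample ω} : Finset (V → Fin q)) := by
        ext ω
        simp only [mem_filter, mem_univ, true_and, insert_subset_iff, mem_sample]
        tauto
      have h4 := card_subset_sample (q := q) (insert w (T o))
      rw [h3]
      by_cases hw : w ∈ T o
      · rw [card_insert_of_mem hw, hT o ho] at h4
        rw [if_pos hw, pow_succ, ← mul_assoc, h4, mul_comm]
        exact Nat.le_add_left _ _
      · rw [card_insert_of_notMem hw, hT o ho] at h4
        rw [h4]
        exact Nat.le_add_right _ _
    refine Nat.le_of_mul_le_mul_right (c := q) ?_ hq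
    rw [mul_assoc, ← pow_succ, sum_mul]
    refine (sum_le_sum h2).trans ?_
    rw [sum_add_distrib, sum_const, ← sum_filter, sum_const, smul_eq_mul, smul_eq_mul]
    have h5 : #{w ∈ ({w ∈ A | G.Adj (r o) w} : Finset V) | w ∈ T o} ≤ j := by
      rw [← hT o ho]
      exact card_le_card fun w hw => (mem_filter.1 hw).2
    calc _ ≤ Δ * q * Q + j * (q * Q) := by gcongr; exact hΔ o ho
      _ = _ := by ring
  have h6 : (∑ ω : V → Fin q, ∑ o ∈ Ω with T o ⊆ sample ω, #{w ∈ A | ω w = 0 ∧ G.Adj (r o) w}) =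
      ∑ o ∈ Ω, ∑ w ∈ A with G.Adj (r o) w, #{ω : V → Fin q | T o ⊆ sample ω ∧ ω w = 0} := by
    simp only [sum_filter, card_filter]
    rw [sum_comm]
    refine sum_congr rfl fun o _ => ?_
    have h7 : ∀ ω : V → Fin q, (if T o ⊆ sample ω then
        ∑ w ∈ A, (if ω w = 0 ∧ G.Adj (r o) w then 1 else 0) else 0) =
        ∑ w ∈ A, if (T o ⊆ sample ω ∧ ω w = 0) ∧ G.Adj (r o) w then 1 else 0 := by
      intro ω
      split_ifs with h
      · simp [h]
      · simp [h]
    rw [sum_congr rfl fun ω _ => h7 ω, sum_comm]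
    refine sum_congr rfl fun w _ => ?_
    split_ifs with h
    · simp [h]
    · simp [h]
  rw [h6, sum_mul]
  refine (sum_le_sum h1).trans (le_of_eq ?_)
  rw [sum_const, smul_eq_mul, mul_assoc]

theorem sum_adj_sampled {q : ℕ} [NeZero q] (A : Finset V) :
    (∑ ω : V → Fin q, ∑ u ∈ A with ω u = 0, #{v ∈ A | ω v = 0 ∧ G.Adj u v}) * q ^ 2 =
      (∑ u ∈ A, #{v ∈ A | G.Adj u v}) * q ^ Fintype.card V := by
  have h1 : (∑ ω : V → Fin q, ∑ u ∈ A with ω u = 0, #{v ∈ A | ω v = 0 ∧ G.Adj u v}) =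
      ∑ u ∈ A, ∑ v ∈ A with G.Adj u v, #{ω : V → Fin q | {u, v} ⊆ sample ω} := by
    simp only [sum_filter, card_filter]
    rw [sum_comm]
    refine sum_congr rfl fun u _ => ?_
    have h2 : ∀ ω : V → Fin q, (if ω u = 0 then
        ∑ v ∈ A, (if ω v = 0 ∧ G.Adj u v then 1 else 0) else 0) =
        ∑ v ∈ A, if {u, v} ⊆ sample ω ∧ G.Adj u v then 1 else 0 := by
      intro ω
      split_ifs with h
      · simp [h, insert_subset_iff, mem_sample]
      · simp [h, insert_subset_iff, mem_sample]
    rw [sum_congr rfl fun ω _ => h2 ω, sum_comm]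
    refine sum_congr rfl fun v _ => ?_
    split_ifs with h
    · simp [h]
    · simp [h]
  rw [h1, sum_mul, sum_mul]
  refine sum_congr rfl fun u _ => ?_
  rw [card_eq_sum_ones, sum_mul, sum_mul]
  refine sum_congr rfl fun v hv => ?_
  have h3 := card_subset_sample (q := q) {u, v}
  rw [card_pair (mem_filter.1 hv).2.ne] at h3
  rw [h3, one_mul]

theorem sum_adj_le_sdiff_add (S R : Finset V) (hR : R ⊆ S) :
    ∑ u ∈ S, #{v ∈ S | G.Adj u v} ≤
      ∑ u ∈ S \ R, #{v ∈ S \ R | G.Adj u v} + 2 * ∑ u ∈ R, #{v ∈ S | G.Adj u v} := by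
  have h1 : ∀ u, #{v ∈ S | G.Adj u v} ≤ #{v ∈ S \ R | G.Adj u v} + #{v ∈ R | G.Adj u v} := by
    intro u
    refine le_trans (card_le_card fun v hv => ?_) (card_union_le _ _)
    simp only [mem_union, mem_filter, mem_sdiff] at hv ⊢
    tauto
  have h2 : ∑ u ∈ S \ R, #{v ∈ R | G.Adj u v} ≤ ∑ u ∈ R, #{v ∈ S | G.Adj u v} := by
    simp only [card_filter]
    rw [sum_comm]
    refine sum_le_sum fun u _ => ?_
    simp only [G.adj_comm u]
    exact sum_le_sum_of_subset sdiff_subset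
  have h3 := sum_sdiff (f := fun u => #{v ∈ S | G.Adj u v}) hR
  have h4 := sum_le_sum (s := S \ R) fun u _ => h1 u
  rw [sum_add_distrib] at h4
  omega

/-- The walks with `i` edges in `A`. -/
def walkTuples (G : SimpleGraph V) [DecidableRel G.Adj] (A : Finset V) (i : ℕ) :
    Finset (Fin (i + 1) → V) :=
  {c ∈ Fintype.piFinset fun _ => A | ∀ a : Fin i, G.Adj (c a.castSucc) (c a.succ)}

theorem card_walkTuples_le {A : Finset V} {Δ : ℕ} (hΔ : ∀ v ∈ A, #{w ∈ A | G.Adj v w} ≤ Δ)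
    (i : ℕ) : #(G.walkTuples A i) ≤ #A * Δ ^ i := by
  induction i with
  | zero =>
    refine (card_filter_le _ _).trans ?_
    simp
  | succ i ih =>
    have h1 : #(G.walkTuples A (i + 1)) ≤ Δ * #(G.walkTuples A i) := by
      refine card_le_mul_card_image_of_maps_to (f := fun c => Fin.init c) ?_ Δ ?_
      · intro c hc
        simp only [walkTuples, mem_filter, Fintype.mem_piFinset] at hc ⊢
        exact ⟨fun a => hc.1 _, fun a => hc.2 a.castSucc⟩
      · intro b hb
        simp only [walkTuples, mem_filter, Fintype.mem_piFinset] at hb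
        refine le_trans (card_le_card_of_injOn (fun c => c (Fin.last _)) ?_ ?_)
          (hΔ (b (Fin.last i)) (hb.1 _))
        · intro c hc
          simp only [walkTuples, mem_coe, mem_filter, Fintype.mem_piFinset] at hc ⊢
          refine ⟨hc.1.1 _, ?_⟩
          rw [← hc.2]
          exact hc.1.2 (Fin.last i)
        · intro c hc c' hc' hcc
          simp only [mem_coe, mem_filter] at hc hc'
          rw [← Fin.snoc_init_self c, ← Fin.snoc_init_self c', hc.2, hc'.2]
          exact congrArg _ hcc
    calc _ ≤ Δ * (#A * Δ ^ i) := h1.trans (Nat.mul_le_mul_left _ ih)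
      _ = _ := by ring

/-- The cycles of length `i + 2` in `A`, as tuples, for which the first and the last but one vertex
have codegree less than `M`. -/
def lightCycles (G : SimpleGraph V) [DecidableRel G.Adj] (A : Finset V) (M i : ℕ) :
    Finset (Fin (i + 2) → V) :=
  {c ∈ G.walkTuples A (i + 1) | (∀ a b, c a = c b → a = b) ∧ G.Adj (c (Fin.last _)) (c 0) ∧
    G.codeg (c (Fin.last i).castSucc) (c 0) < M}

theorem card_lightCycles_le {A : Finset V} {Δ M : ℕ} (hΔ : ∀ v ∈ A, #{w ∈ A | G.Adj v w} ≤ Δ)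
    (i : ℕ) : #(G.lightCycles A M i) ≤ M * (#A * Δ ^ i) := by
  refine le_trans ?_ (Nat.mul_le_mul_left M (card_walkTuples_le hΔ i))
  refine card_le_mul_card_image_of_maps_to (f := fun c => Fin.init c) ?_ M ?_
  · intro c hc
    simp only [lightCycles, walkTuples, mem_filter, Fintype.mem_piFinset] at hc ⊢
    exact ⟨fun a => hc.1.1 _, fun a => hc.1.2 a.castSucc⟩
  · intro b hb
    rcases ({c ∈ G.lightCycles A M i | Fin.init c = b}).eq_empty_or_nonempty with h0 | ⟨c₀, hc₀⟩
    · simp [h0]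
    simp only [lightCycles, mem_filter] at hc₀
    refine le_trans (card_le_card_of_injOn (fun c => c (Fin.last _)) ?_ ?_) hc₀.1.2.2.2.le
    · intro c hc
      simp only [lightCycles, walkTuples, mem_coe, mem_filter, Fintype.mem_piFinset] at hc
      have h1 : ∀ a, c (Fin.castSucc a) = c₀ (Fin.castSucc a) :=
        fun a => congrFun (hc.2.trans hc₀.2.symm) a
      refine mem_coe.2 (mem_filter.2 ⟨mem_univ _, ?_, ?_⟩)
      · rw [← h1]
        exact hc.1.1.2 (Fin.last i)
      · have h2 := h1 0
        rw [Fin.castSucc_zero] at h2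
        rw [← h2]
        exact hc.1.2.2.1.symm
    · intro c hc c' hc' hcc
      simp only [mem_coe, mem_filter] at hc hc'
      rw [← Fin.snoc_init_self c, ← Fin.snoc_init_self c', hc.2, hc'.2]
      exact congrArg _ hcc

open Classical in
/-- Paths `u, v, w` in `A`, listed as `(v, u, w)`, whose ends form a crowded pair. -/
noncomputable def crowdedCherries (G : SimpleGraph V) [DecidableRel G.Adj] (A : Finset V) (M : ℕ) :
    Finset (Σ _ : V, Σ _ : V, V) :=
  A.sigma fun v => ({u ∈ A | G.Adj v u} : Finset V).sigma fun u =>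
    {w ∈ A | G.Adj v w ∧ G.Crowded M u w}

/-- A subset of `A` that contains no crowded cherry and no light cycle of length less than `4 k`
spans no cycle of length less than `4 k`. It then spans no cycle at all, because a shortest one
would be induced, and so it spans no more edges than it has vertices. -/
theorem sum_adj_le_of_no_short_cycle (hG : G.LongInducedCycleFree (4 * k)) {A S : Finset V} {M : ℕ}
    (hSA : S ⊆ A)
    (h1 : ∀ v u w, v ∈ S → u ∈ S → w ∈ S → ⟨v, u, w⟩ ∉ G.crowdedCherries A M)
    (h2 : ∀ i < 4 * k, ∀ c ∈ G.lightCycles A M i, ∃ a, c a ∉ S) :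
    ∑ u ∈ S, #{v ∈ S | G.Adj u v} ≤ 2 * #S := by
  classical
  by_contra hcon
  push Not at hcon
  obtain ⟨S', hS', hne, hdeg⟩ := exists_minDegree_of_sum (m := 1) G S (by simpa using hcon)
  obtain ⟨L, c, -, hc⟩ := exists_isCyclicSeq_of_minDegree G hne le_rfl hdeg
  obtain ⟨n, hn3, hn, hcont⟩ := hc.exists_isIndContained (t := 4 * k) (by
    intro L c hc
    by_contra hL
    push Not at hL
    have hL3 := hc.three_le
    obtain ⟨i, rfl⟩ : ∃ i, L = i + 2 := ⟨L - 2, by omega⟩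
    have hmem : ∀ j, j < i + 2 → c j ∈ S := fun j hj => hS' (hc.mem j hj)
    have hclose : G.Adj (c (i + 1)) (c 0) := hc.close
    have hne : c i ≠ c 0 := fun h => by
      have := hc.inj i (by omega) 0 (by omega) h
      omega
    by_cases hcr : G.Crowded M (c i) (c 0)
    · refine h1 (c (i + 1)) (c i) (c 0) (hmem _ (by omega)) (hmem _ (by omega))
        (hmem _ (by omega)) ?_
      simp only [crowdedCherries, mem_sigma, mem_filter]
      exact ⟨hSA (hmem _ (by omega)), ⟨hSA (hmem _ (by omega)), (hc.adj i (by omega)).symm⟩,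
        hSA (hmem _ (by omega)), hclose, hcr⟩
    · obtain ⟨a, ha⟩ := h2 i (by omega) (fun a => c a) (by
        simp only [lightCycles, walkTuples, mem_filter, Fintype.mem_piFinset]
        refine ⟨⟨fun a => hSA (hmem _ a.2), fun a => ?_⟩, ?_, ?_, ?_⟩
        · simpa using hc.adj a (by omega)
        · intro a b hab
          exact Fin.ext (hc.inj _ a.2 _ b.2 hab)
        · simpa using hclose
        · by_contra hM
          exact hcr ⟨hne, Or.inr (by simpa using hM)⟩)
      exact ha (hmem _ a.2))
  exact hG n hn3 hn hcont

open Classical in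
/-- An almost regular set with few crowded cherries spans few edges. Otherwise a random sample with
probability `1 / q`, from which one vertex of each crowded cherry and each short light cycle is
removed, still spans more edges than it has vertices; but it spans no cycle. -/
theorem sum_adj_le_of_almost_regular (hG : G.LongInducedCycleFree (4 * k)) {A : Finset V}
    {x κ q M ρ : ℕ} (hq : 0 < q) (hx : 4 * k + 2 ≤ x)
    (hΔ : ∀ v ∈ A, #{w ∈ A | G.Adj v w} ≤ x ^ κ * q)
    (hcr : ∀ v ∈ A, ∑ u ∈ A with G.Adj v u, #{w ∈ A | G.Adj v w ∧ G.Crowded M u w} ≤ ρ)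
    (hρ : ρ * x ^ (κ + 2) ≤ q ^ 2) (hM : M * x ^ (κ * (4 * k) + κ + 2) ≤ q) :
    ∑ v ∈ A, #{w ∈ A | G.Adj v w} ≤ 6 * #A * q := by
  have : NeZero q := ⟨hq.ne'⟩
  have hx1 : 1 ≤ x := by omega
  have hx2 : 2 ≤ x := by omega
  set Q := q ^ Fintype.card V with hQ
  have hQ0 : 0 < Q := by positivity
  set n := #A with hn
  let deg : (V → Fin q) → V → ℕ := fun ω v => #{w ∈ A | ω w = 0 ∧ G.Adj v w}
  -- the vertex sets and the roots of the configurations that are to be destroyed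
  let T₀ : (Σ _ : V, Σ _ : V, V) → Finset V := fun o => {o.1, o.2.1, o.2.2}
  let T₁ : ∀ i, (Fin (i + 2) → V) → Finset V := fun i c => univ.image c
  let E₀ : (V → Fin q) → ℕ := fun ω =>
    ∑ o ∈ G.crowdedCherries A M with T₀ o ⊆ sample ω, deg ω o.1
  let E₁ : ℕ → (V → Fin q) → ℕ := fun i ω =>
    ∑ c ∈ G.lightCycles A M i with T₁ i c ⊆ sample ω, deg ω (c 0)
  have hpoint : ∀ ω : V → Fin q, ∑ u ∈ A with ω u = 0, #{v ∈ A | ω v = 0 ∧ G.Adj u v} ≤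
      2 * #{a ∈ A | ω a = 0} + 2 * (E₀ ω + ∑ i ∈ range (4 * k), E₁ i ω) := by
    intro ω
    set S : Finset V := {a ∈ A | ω a = 0} with hS
    let R₀ : Finset V := ({o ∈ G.crowdedCherries A M | T₀ o ⊆ sample ω}).image fun o => o.1
    let R₁ : Finset V := ((range (4 * k)).sigma
      fun i => {c ∈ G.lightCycles A M i | T₁ i c ⊆ sample ω}).image fun p => p.2 0
    set R := (R₀ ∪ R₁) ∩ S with hR
    have hSdeg : ∀ u, #{v ∈ S | G.Adj u v} = deg ω u := by
      intro u
      simp only [deg, hS, filter_filter]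
    have h1 := sum_adj_le_sdiff_add (G := G) S R inter_subset_right
    have h2 : ∑ u ∈ R, #{v ∈ S | G.Adj u v} ≤ E₀ ω + ∑ i ∈ range (4 * k), E₁ i ω := by
      simp only [hSdeg]
      calc ∑ u ∈ R, deg ω u ≤ ∑ u ∈ R₀ ∪ R₁, deg ω u :=
            sum_le_sum_of_subset inter_subset_left
        _ ≤ ∑ u ∈ R₀, deg ω u + ∑ u ∈ R₁, deg ω u := by
            rw [← sum_union_inter]; exact Nat.le_add_right _ _
        _ ≤ E₀ ω + ∑ i ∈ range (4 * k), E₁ i ω := by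
            refine Nat.add_le_add ?_ ?_
            · exact sum_image_le_of_nonneg (fun _ _ => Nat.zero_le _)
            · refine (sum_image_le_of_nonneg (fun _ _ => Nat.zero_le _)).trans (le_of_eq ?_)
              rw [sum_sigma]
    have hmemS : ∀ v, v ∈ S → ω v = 0 := fun v hv => (mem_filter.1 hv).2
    have h3 := sum_adj_le_of_no_short_cycle (M := M) hG (A := A) (S := S \ R)
      (sdiff_subset.trans (filter_subset _ _)) (by
        intro v u w hv hu hw ho
        rw [mem_sdiff] at hv hu hw
        refine hv.2 (mem_inter.2 ⟨mem_union_left _ (mem_image.2 ⟨⟨v, u, w⟩,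
          mem_filter.2 ⟨ho, ?_⟩, rfl⟩), hv.1⟩)
        simp only [T₀, insert_subset_iff, singleton_subset_iff, mem_sample]
        exact ⟨hmemS _ hv.1, hmemS _ hu.1, hmemS _ hw.1⟩) (by
        intro i hi c hc
        by_contra hcon
        push Not at hcon
        have hcS : ∀ a, c a ∈ S := fun a => (mem_sdiff.1 (hcon a)).1
        refine (mem_sdiff.1 (hcon 0)).2 (mem_inter.2 ⟨mem_union_right _ (mem_image.2
          ⟨⟨i, c⟩, mem_sigma.2 ⟨mem_range.2 hi, mem_filter.2 ⟨hc, ?_⟩⟩, rfl⟩), hcS 0⟩)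
        intro v hv
        obtain ⟨a, -, rfl⟩ := mem_image.1 hv
        exact mem_sample.2 (hmemS _ (hcS a)))
    have h4 : #(S \ R) ≤ #S := card_le_card sdiff_subset
    have h5 : ∑ u ∈ S, #{v ∈ A | ω v = 0 ∧ G.Adj u v} = ∑ u ∈ S, #{v ∈ S | G.Adj u v} :=
      sum_congr rfl fun u _ => (hSdeg u).symm
    rw [h5]
    omega
  have hE₀ : (∑ ω, E₀ ω) * q ≤ n * Q := by
    have h1 : #(G.crowdedCherries A M) ≤ n * ρ := by
      simp only [crowdedCherries, card_sigma]
      refine (sum_le_sum hcr).trans ?_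
      rw [sum_const, smul_eq_mul]
    have h2 := sum_degree_sampled_le (G := G) (q := q) (A := A) (Δ := x ^ κ) (j := 3)
      (G.crowdedCherries A M) T₀ (fun o => o.1) (by
        rintro ⟨v, u, w⟩ ho
        simp only [crowdedCherries, mem_sigma, mem_filter] at ho
        exact card_eq_three.2 ⟨v, u, w, ho.2.1.2.ne, ho.2.2.2.1.ne, ho.2.2.2.2.1, rfl⟩) (by
        rintro ⟨v, u, w⟩ ho
        simp only [crowdedCherries, mem_sigma] at ho
        exact hΔ v ho.1)
    have h3 : 3 + x ^ κ ≤ x ^ (κ + 2) := by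
      have h31 : 1 ≤ x ^ κ := Nat.one_le_pow _ _ hx1
      have h32 : 4 ≤ x ^ 2 := by nlinarith
      rw [pow_add]
      nlinarith
    refine Nat.le_of_mul_le_mul_right (c := q ^ 2) ?_ (by positivity)
    calc (∑ ω, E₀ ω) * q * q ^ 2 = (∑ ω, E₀ ω) * q ^ 3 := by ring
      _ ≤ #(G.crowdedCherries A M) * (3 + x ^ κ) * Q := h2
      _ ≤ n * ρ * x ^ (κ + 2) * Q := by gcongr
      _ = n * Q * (ρ * x ^ (κ + 2)) := by ring
      _ ≤ n * Q * q ^ 2 := Nat.mul_le_mul_left _ hρ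
  have hE₁ : ∀ i ∈ range (4 * k), (∑ ω, E₁ i ω) * q ^ 2 ≤
      M * n * x ^ (κ * (4 * k) + κ + 1) * Q := by
    intro i hi
    rw [mem_range] at hi
    have h1 := card_lightCycles_le (M := M) hΔ i
    have h2 := sum_degree_sampled_le (G := G) (q := q) (A := A) (Δ := x ^ κ) (j := i + 2)
      (G.lightCycles A M i) (T₁ i) (fun c => c 0) (by
        intro c hc
        simp only [lightCycles, mem_filter] at hc
        simp only [T₁]
        rw [card_image_of_injective _ (fun a b => hc.2.1 a b), card_univ, Fintype.card_fin]) (by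
        intro c hc
        simp only [lightCycles, walkTuples, mem_filter, Fintype.mem_piFinset] at hc
        exact hΔ _ (hc.1.1 0))
    have h3 : i + 2 + x ^ κ ≤ x ^ (κ + 1) := by
      have h31 : 1 ≤ x ^ κ := Nat.one_le_pow _ _ hx1
      rw [pow_succ]
      nlinarith
    have h4 : x ^ (κ * i) ≤ x ^ (κ * (4 * k)) :=
      Nat.pow_le_pow_right hx1 (Nat.mul_le_mul_left _ hi.le)
    refine Nat.le_of_mul_le_mul_right (c := q ^ i) ?_ (by positivity)
    calc (∑ ω, E₁ i ω) * q ^ 2 * q ^ i = (∑ ω, E₁ i ω) * q ^ (i + 2) := by ring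
      _ ≤ #(G.lightCycles A M i) * (i + 2 + x ^ κ) * Q := h2
      _ ≤ M * (n * (x ^ κ * q) ^ i) * x ^ (κ + 1) * Q := by gcongr
      _ = M * n * x ^ (κ * i) * x ^ (κ + 1) * Q * q ^ i := by rw [mul_pow, ← pow_mul]; ring
      _ ≤ M * n * x ^ (κ * (4 * k)) * x ^ (κ + 1) * Q * q ^ i := by gcongr
      _ = _ := by ring
  have hE₁' : (∑ ω, ∑ i ∈ range (4 * k), E₁ i ω) * q ^ 2 ≤ n * q * Q := by
    rw [sum_comm, sum_mul]
    refine (sum_le_sum hE₁).trans ?_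
    rw [sum_const, card_range, smul_eq_mul]
    calc 4 * k * (M * n * x ^ (κ * (4 * k) + κ + 1) * Q)
        ≤ x * (M * n * x ^ (κ * (4 * k) + κ + 1) * Q) := Nat.mul_le_mul_right _ (by omega)
      _ = n * Q * (M * x ^ (κ * (4 * k) + κ + 2)) := by ring
      _ ≤ n * Q * q := Nat.mul_le_mul_left _ hM
      _ = _ := by ring
  refine Nat.le_of_mul_le_mul_right (c := Q) ?_ hQ0
  rw [← sum_adj_sampled]
  calc _ ≤ (∑ ω : V → Fin q, (2 * #{a ∈ A | ω a = 0} +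
          2 * (E₀ ω + ∑ i ∈ range (4 * k), E₁ i ω))) * q ^ 2 :=
        Nat.mul_le_mul_right _ (sum_le_sum fun ω _ => hpoint ω)
    _ = 2 * ((∑ ω : V → Fin q, #{a ∈ A | ω a = 0}) * q) * q + 2 * ((∑ ω, E₀ ω) * q) * q +
          2 * ((∑ ω, ∑ i ∈ range (4 * k), E₁ i ω) * q ^ 2) := by
        simp only [sum_add_distrib, ← mul_sum]
        ring
    _ ≤ 2 * (n * Q) * q + 2 * (n * Q) * q + 2 * (n * q * Q) := by
        rw [sum_card_inter_sample]
        gcongr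
    _ = _ := by ring

end Regular

/-! ### Degenerate graphs -/

section Degenerate

variable {V : Type*} [DecidableEq V] {G : SimpleGraph V} [DecidableRel G.Adj] {S : Finset V} {d : ℕ}

/-- The subgraph induced on `S` is `d`-degenerate. -/
def DegenerateOn (G : SimpleGraph V) [DecidableRel G.Adj] (S : Finset V) (d : ℕ) : Prop :=
  ∀ T ⊆ S, T.Nonempty → ∃ v ∈ T, #{w ∈ T | G.Adj v w} ≤ d

theorem DegenerateOn.mono (h : G.DegenerateOn S d) {T : Finset V} (hT : T ⊆ S) :
    G.DegenerateOn T d := fun U hU hne => h U (hU.trans hT) hne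

theorem DegenerateOn.sum_adj_le (h : G.DegenerateOn S d) :
    ∑ v ∈ S, #{w ∈ S | G.Adj v w} ≤ 2 * d * #S := by
  induction S using Finset.strongInduction with
  | H S ih =>
    rcases S.eq_empty_or_nonempty with rfl | hne
    · simp
    obtain ⟨v, hv, hvd⟩ := h S Subset.rfl hne
    have h1 := sum_card_filter_adj_erase G S hv
    have h2 := ih (S.erase v) (erase_ssubset hv) (h.mono (erase_subset _ _))
    have h3 := card_erase_add_one hv
    rw [h1, ← h3]
    nlinarith

theorem DegenerateOn.exists_orientation (h : G.DegenerateOn S d) :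
    ∃ O : V → Finset V, (∀ u, #(O u) ≤ d) ∧
      ∀ u ∈ S, ∀ v ∈ S, G.Adj u v → v ∈ O u ∨ u ∈ O v := by
  induction S using Finset.strongInduction with
  | H S ih =>
    rcases S.eq_empty_or_nonempty with rfl | hne
    · exact ⟨fun _ => ∅, by simp, by simp⟩
    obtain ⟨v, hv, hvd⟩ := h S Subset.rfl hne
    obtain ⟨O, hO, hO'⟩ := ih (S.erase v) (erase_ssubset hv) (h.mono (erase_subset _ _))
    refine ⟨Function.update O v {w ∈ S | G.Adj v w}, fun u => ?_, fun u hu w hw huw => ?_⟩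
    · by_cases huv : u = v
      · rw [huv, Function.update_self]; exact hvd
      · rw [Function.update_of_ne huv]; exact hO u
    · by_cases huv : u = v
      · subst huv
        left
        rw [Function.update_self]
        exact mem_filter.2 ⟨hw, huw⟩
      by_cases hwv : w = v
      · subst hwv
        right
        rw [Function.update_self]
        exact mem_filter.2 ⟨hu, huw.symm⟩
      rw [Function.update_of_ne huv, Function.update_of_ne hwv]
      exact hO' u (mem_erase.2 ⟨huv, hu⟩) w (mem_erase.2 ⟨hwv, hw⟩) huw

theorem DegenerateOn.exists_stable (h : G.DegenerateOn S d) :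
    ∃ I ⊆ S, (∀ u ∈ I, ∀ v ∈ I, ¬ G.Adj u v) ∧ #S ≤ (d + 1) * #I := by
  induction S using Finset.strongInduction with
  | H S ih =>
    rcases S.eq_empty_or_nonempty with rfl | hne
    · exact ⟨∅, by simp, by simp, by simp⟩
    obtain ⟨v, hv, hvd⟩ := h S Subset.rfl hne
    set T := {w ∈ S.erase v | ¬ G.Adj v w} with hT
    have hTS : T ⊆ S := (filter_subset _ _).trans (erase_subset _ _)
    have hvT : v ∉ T := by simp [hT]
    obtain ⟨I, hI, hIs, hIc⟩ := ih T ⟨hTS, fun hss => hvT (hss hv)⟩ (h.mono hTS)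
    have hadj : ∀ u ∈ I, ¬ G.Adj v u := fun u hu => (mem_filter.1 (hI hu)).2
    refine ⟨insert v I, ?_, ?_, ?_⟩
    · intro u hu
      rcases mem_insert.1 hu with rfl | hu
      · exact hv
      · exact hTS (hI hu)
    · intro u hu w hw
      rcases mem_insert.1 hu with hu | hu <;> rcases mem_insert.1 hw with hw | hw
      · rw [hu, hw]; exact G.irrefl
      · rw [hu]; exact hadj w hw
      · rw [hw]; exact fun h => hadj u hu h.symm
      · exact hIs u hu w hw
    · rw [card_insert_of_notMem fun hvI => hvT (hI hvI)]
      have h1 := card_filter_add_card_filter_not (s := S.erase v) (fun w => G.Adj v w)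
      have h2 := card_erase_add_one hv
      have h3 : #{w ∈ S.erase v | G.Adj v w} ≤ #{w ∈ S | G.Adj v w} :=
        card_le_card (filter_subset_filter _ (erase_subset _ _))
      rw [← hT] at h1
      nlinarith

theorem encard_neighborSet_induce (S : Finset V) (v : (S : Set V)) :
    ((G.induce (S : Set V)).neighborSet v).encard = (#{w ∈ S | G.Adj v w} : ℕ∞) := by
  rw [← Subtype.val_injective.encard_image, ← Set.encard_coe_eq_coe_finsetCard]
  congr 1
  ext w
  simp [and_comm]

end Degenerate

/-! ### The minimum degree of a degenerate graph -/

section MinDegree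

variable {V : Type*} [Fintype V] [DecidableEq V] {G : SimpleGraph V} [DecidableRel G.Adj]
  {ℓ x k : ℕ}

/-- The density of crowded pairs in large sets will be bounded by `x ^ (-savingExp k)`, which makes
crowded cherries rare in the random sample of an almost regular graph. -/
def savingExp (k : ℕ) : ℕ := 3 * heavyExp k + 47

/-- An exponent such that no tame graph is both `d`-degenerate and of minimum degree at least `d` if
`x ^ a ≤ d ≤ x ^ (a + 1)` for some `a` that is at least this exponent. -/
def degExp (k : ℕ) : ℕ :=
  crowdExp k (savingExp k) + 2 * heavyExp k + 50 + (heavyExp k + 15) * (4 * k) + heavyExp k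

theorem IsTame.large (h : G.IsTame ℓ x k) : 1024 ≤ x ∧ 8 * k ≤ x ∧ 4 * k + 2 ≤ x := by
  have h1 := h.const_le
  have h2 := h.two_le
  have h3 : 2 ^ 4 ≤ 2 ^ (2 * k) := Nat.pow_le_pow_right (by omega) (by omega)
  have h4 : 4 ^ 3 ≤ (2 * k) ^ 3 := Nat.pow_le_pow_left (by omega) 3
  have h5 : 4 ^ 3 * 2 ^ 4 ≤ (2 * k) ^ 3 * 2 ^ (2 * k) := Nat.mul_le_mul h4 h3
  have h6 := h.le_x.1
  have h7 : 8 * k ≤ (2 * k) ^ 2 := by nlinarith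
  omega

open Classical in
/-- A vertex set `B` all of whose members have many, but not too many, neighbours in `A` is not much
larger than `A`. -/
theorem IsTame.card_le_of_nbrs (h : G.IsTame ℓ x k) {A B : Finset V} {a d : ℕ}
    (ha : degExp k ≤ a) (hdx : d ≤ x ^ (a + 1)) (hxd : x ^ a ≤ d)
    (hA : G.DegenerateOn A d) (hB : G.DegenerateOn B d)
    (hlow : ∀ b ∈ B, d ≤ 2 * #{v ∈ A | G.Adj b v}) (hup : ∀ b ∈ B, #{v ∈ A | G.Adj b v} ≤ 8 * d) :
    #B ≤ x ^ (heavyExp k + 9) * #A := by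
  obtain ⟨hx, hkx, -⟩ := h.large
  have hx1 : 1 ≤ x := by omega
  have hk := h.two_le
  obtain ⟨O, hO, hO'⟩ := hA.exists_orientation
  obtain ⟨I, hI, hIs, hIc⟩ := hB.exists_stable
  have ha' : crowdExp k (savingExp k) + 50 ≤ a := by unfold degExp at ha; omega
  obtain ⟨a', rfl⟩ : ∃ a', a = a' + 3 := ⟨a - 3, by omega⟩
  have hpairs : ∀ b ∈ I, x ^ (2 * a' + 3) ≤ ∑ u ∈ A with G.Adj b u,
      #{v ∈ A | G.Adj b v ∧ u ≠ v ∧ ¬ G.Crowded (x ^ heavyExp k) u v} := by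
    intro b hb
    set N := {u ∈ A | G.Adj b u} with hN
    have h1 : x ^ (a' + 2) ≤ #N := by
      have h11 : 2 * x ^ (a' + 2) ≤ x ^ (a' + 3) := by
        rw [pow_succ x (a' + 2), mul_comm]
        exact Nat.mul_le_mul_left _ (by omega)
      have h12 := hlow b (hI hb)
      rw [← hN] at h12
      omega
    have h2 := h.sum_crowded_le (savingExp k) N
      ((Nat.pow_le_pow_right hx1 (by omega)).trans h1)
    have h3 : 4 * ∑ u ∈ N, #{v ∈ N | G.Crowded (x ^ heavyExp k) u v} ≤ #N ^ 2 := by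
      refine le_trans (Nat.mul_le_mul_right _ ?_) h2
      calc 4 ≤ x := by omega
        _ ≤ x ^ savingExp k := Nat.le_self_pow (by unfold savingExp; omega) x
    have h4 : ∀ u ∈ N, #N ≤ #{v ∈ A | G.Adj b v ∧ u ≠ v ∧ ¬ G.Crowded (x ^ heavyExp k) u v} +
        #{v ∈ N | G.Crowded (x ^ heavyExp k) u v} + 1 := by
      intro u _
      have h41 : N ⊆ ({v ∈ A | G.Adj b v ∧ u ≠ v ∧ ¬ G.Crowded (x ^ heavyExp k) u v} ∪
          {v ∈ N | G.Crowded (x ^ heavyExp k) u v}) ∪ {u} := by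
        intro v hv
        have hv' := mem_filter.1 hv
        rw [mem_union, mem_union, mem_filter, mem_filter, mem_singleton]
        by_cases huv : v = u
        · exact Or.inr huv
        · by_cases hc : G.Crowded (x ^ heavyExp k) u v
          · exact Or.inl (Or.inr ⟨hv, hc⟩)
          · exact Or.inl (Or.inl ⟨hv'.1, hv'.2, Ne.symm huv, hc⟩)
      refine (card_le_card h41).trans ((card_union_le _ _).trans ?_)
      rw [card_singleton]
      exact Nat.add_le_add_right (card_union_le _ _) 1
    have h5 := sum_le_sum h4
    rw [sum_add_distrib, sum_add_distrib, sum_const, sum_const, smul_eq_mul, smul_eq_mul,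
      mul_one] at h5
    have h6 : 4 ≤ #N := le_trans (by
      calc 4 ≤ x := by omega
        _ ≤ x ^ (a' + 2) := Nat.le_self_pow (by omega) x) h1
    have h7 : 2 * x ^ (2 * a' + 3) ≤ #N ^ 2 := by
      calc 2 * x ^ (2 * a' + 3) ≤ x * x ^ (2 * a' + 3) := Nat.mul_le_mul_right _ (by omega)
        _ = (x ^ (a' + 2)) ^ 2 := by ring
        _ ≤ #N ^ 2 := Nat.pow_le_pow_left h1 2
    nlinarith
  have hbound := card_mul_le_of_light_pairs (q := x ^ (a' + 6)) (y := 8 * d)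
    h.longInducedCycleFree (by omega) hIs hO' hO (fun b hb => hup b (hI hb)) hpairs (by
      calc 2 * (2 * d + 8 * d) = 20 * d := by ring
        _ ≤ x * x ^ (a' + 3 + 1) := Nat.mul_le_mul (by omega) hdx
        _ = x ^ (a' + 5) := by ring
        _ ≤ x ^ (a' + 6) := Nat.pow_le_pow_right hx1 (by omega)) (by positivity)
  have hd1 : d + 1 ≤ x ^ (a' + 5) := by
    have h1 : 1 ≤ x ^ (a' + 3 + 1) := Nat.one_le_pow _ _ hx1
    calc d + 1 ≤ 2 * x ^ (a' + 3 + 1) := by omega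
      _ ≤ x * x ^ (a' + 3 + 1) := Nat.mul_le_mul_right _ (by omega)
      _ = _ := by ring
  refine Nat.le_of_mul_le_mul_left (c := x ^ (2 * a' + 3)) ?_ (by positivity)
  calc x ^ (2 * a' + 3) * #B ≤ x ^ (2 * a' + 3) * (x ^ (a' + 5) * #I) := by
        gcongr
        exact hIc.trans (Nat.mul_le_mul_right _ hd1)
    _ = x ^ (a' + 5) * (#I * x ^ (2 * a' + 3)) := by ring
    _ ≤ x ^ (a' + 5) * (8 * k * x ^ heavyExp k * x ^ (a' + 6) * #A) := by gcongr
    _ ≤ x ^ (a' + 5) * (x * x ^ heavyExp k * x ^ (a' + 6) * #A) := by gcongr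
    _ = x ^ (2 * a' + 3) * (x ^ (heavyExp k + 9) * #A) := by ring

/-- A tame graph is not both `d`-degenerate and of minimum degree at least `d` when `d` is large:
the vertices of high degree are few, and few vertices have half of their neighbours among them, so
that the other vertices form an almost regular graph with many edges. -/
theorem IsTame.false_of_minDegree (h : G.IsTame ℓ x k) {S : Finset V} (hS : S.Nonempty) {a d : ℕ}
    (ha : degExp k ≤ a) (hdx : d ≤ x ^ (a + 1)) (hxd : x ^ a ≤ d) (hdeg : G.DegenerateOn S d)
    (hmin : ∀ v ∈ S, d ≤ #{w ∈ S | G.Adj v w}) : False := by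
  classical
  obtain ⟨hx, hkx, hkx'⟩ := h.large
  have hx1 : 1 ≤ x := by omega
  have hk := h.two_le
  set μ := heavyExp k with hμ
  have hd0 : 0 < d := lt_of_lt_of_le (by positivity) hxd
  set n := #S with hn
  have hn0 : 0 < n := card_pos.2 hS
  have hsum := hdeg.sum_adj_le
  set Δ := x ^ (a + μ + 12) with hΔ
  -- the number of vertices whose degree exceeds a given bound
  have hmarkov : ∀ D, D * #{v ∈ S | D < #{w ∈ S | G.Adj v w}} ≤ 2 * d * n := by
    intro D
    refine le_trans ?_ hsum
    calc _ = ∑ v ∈ S with D < #{w ∈ S | G.Adj v w}, D := by rw [sum_const, smul_eq_mul, mul_comm]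
      _ ≤ ∑ v ∈ S with D < #{w ∈ S | G.Adj v w}, #{w ∈ S | G.Adj v w} :=
          sum_le_sum fun v hv => (mem_filter.1 hv).2.le
      _ ≤ _ := sum_le_sum_of_subset (filter_subset _ _)
  set A := {v ∈ S | Δ < #{w ∈ S | G.Adj v w}} with hA
  set H := {v ∈ S | 8 * d < #{w ∈ S | G.Adj v w}} with hH
  set B := {v ∈ S | #{w ∈ S | G.Adj v w} ≤ 8 * d ∧ d ≤ 2 * #{w ∈ A | G.Adj v w}} with hB
  set A₁ := S \ A with hA₁
  have hAS : A ⊆ S := filter_subset _ _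
  have hBS : B ⊆ S := filter_subset _ _
  have hHc : 4 * #H ≤ n := by
    refine Nat.le_of_mul_le_mul_left (c := 2 * d) ?_ (by omega)
    refine le_trans (le_of_eq ?_) (hmarkov (8 * d))
    ring
  have hAc : x ^ (μ + 11) * #A ≤ 2 * n := by
    refine Nat.le_of_mul_le_mul_left (c := x ^ (a + 1)) ?_ (by positivity)
    calc x ^ (a + 1) * (x ^ (μ + 11) * #A) = Δ * #A := by rw [hΔ]; ring
      _ ≤ 2 * d * n := hmarkov Δ
      _ ≤ 2 * x ^ (a + 1) * n := by gcongr
      _ = _ := by ring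
  have hBc : 4 * #B ≤ n := by
    have h1 := h.card_le_of_nbrs ha hdx hxd (hdeg.mono hAS) (hdeg.mono hBS)
      (fun b hb => (mem_filter.1 hb).2.2)
      (fun b hb => (card_le_card (filter_subset_filter _ hAS)).trans (mem_filter.1 hb).2.1)
    have h2 : x ^ 2 * #B ≤ 2 * n := by
      calc x ^ 2 * #B ≤ x ^ 2 * (x ^ (μ + 9) * #A) := Nat.mul_le_mul_left _ h1
        _ = x ^ (μ + 11) * #A := by ring
        _ ≤ 2 * n := hAc
    have h3 : 8 ≤ x ^ 2 := by nlinarith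
    nlinarith
  -- the vertices outside `H` and `B` have at least `d / 2` neighbours in `A₁`
  have hmany : n * d ≤ 4 * ∑ v ∈ A₁, #{w ∈ A₁ | G.Adj v w} := by
    set C := S \ (H ∪ B) with hC
    have h1 : n ≤ 2 * #C := by
      have h11 := le_card_sdiff (H ∪ B) S
      have h12 := card_union_le H B
      rw [← hC] at h11
      omega
    have hCA : C ⊆ A₁ := by
      intro v hv
      rw [hC, mem_sdiff, mem_union, not_or] at hv
      refine mem_sdiff.2 ⟨hv.1, fun hvA => hv.2.1 (mem_filter.2 ⟨hv.1, ?_⟩)⟩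
      refine lt_of_le_of_lt ?_ (mem_filter.1 hvA).2
      calc 8 * d ≤ x * x ^ (a + 1) := Nat.mul_le_mul (by omega) hdx
        _ = x ^ (a + 2) := by ring
        _ ≤ Δ := Nat.pow_le_pow_right hx1 (by omega)
    have h2 : ∀ v ∈ C, d ≤ 2 * #{w ∈ A₁ | G.Adj v w} := by
      intro v hv
      rw [hC, mem_sdiff, mem_union, not_or] at hv
      have h21 : #{w ∈ S | G.Adj v w} ≤ 8 * d := by
        by_contra hcon
        exact hv.2.1 (mem_filter.2 ⟨hv.1, by omega⟩)
      have h22 : 2 * #{w ∈ A | G.Adj v w} < d := by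
        by_contra hcon
        exact hv.2.2 (mem_filter.2 ⟨hv.1, h21, by omega⟩)
      have h23 : #{w ∈ S | G.Adj v w} ≤ #{w ∈ A₁ | G.Adj v w} + #{w ∈ A | G.Adj v w} := by
        refine le_trans (card_le_card fun w hw => ?_) (card_union_le _ _)
        rw [mem_filter] at hw
        rw [mem_union, mem_filter, mem_filter, hA₁, mem_sdiff]
        by_cases hwA : w ∈ A
        · exact Or.inr ⟨hwA, hw.2⟩
        · exact Or.inl ⟨⟨hw.1, hwA⟩, hw.2⟩
      have := hmin v hv.1
      omega
    have h3 := sum_le_sum h2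
    rw [sum_const, smul_eq_mul, ← mul_sum] at h3
    have h4 := sum_le_sum_of_subset (f := fun v => #{w ∈ A₁ | G.Adj v w}) hCA
    have h5 := Nat.mul_le_mul_right d h1
    nlinarith
  obtain ⟨q', hq'⟩ : ∃ q', a = q' + 3 := ⟨a - 3, by unfold degExp at ha; omega⟩
  have hΔ' : ∀ v ∈ A₁, #{w ∈ A₁ | G.Adj v w} ≤ x ^ (μ + 15) * x ^ q' := by
    intro v hv
    rw [← pow_add, show μ + 15 + q' = a + μ + 12 by omega]
    rw [hA₁, mem_sdiff] at hv
    by_contra hcon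
    refine hv.2 (mem_filter.2 ⟨hv.1, lt_of_lt_of_le (not_le.1 hcon) (card_le_card ?_)⟩)
    exact filter_subset_filter _ sdiff_subset
  have haexp : crowdExp k (savingExp k) + 2 * μ + 50 + (μ + 15) * (4 * k) + μ ≤ a := ha
  have hcr : ∀ v ∈ A₁, ∑ u ∈ A₁ with G.Adj v u,
      #{w ∈ A₁ | G.Adj v w ∧ G.Crowded (x ^ μ) u w} ≤ x ^ (2 * q' - (μ + 17)) := by
    intro v hv
    set N := {u ∈ A₁ | G.Adj v u} with hN
    have h1 : ∑ u ∈ N, #{w ∈ A₁ | G.Adj v w ∧ G.Crowded (x ^ μ) u w} =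
        ∑ u ∈ N, #{w ∈ N | G.Crowded (x ^ μ) u w} := by
      simp only [hN, filter_filter]
    rw [h1]
    by_cases hbig : x ^ crowdExp k (savingExp k) ≤ #N
    · have h2 := h.sum_crowded_le (savingExp k) N hbig
      refine Nat.le_of_mul_le_mul_left (c := x ^ savingExp k) ?_ (by positivity)
      calc _ ≤ #N ^ 2 := h2
        _ ≤ (x ^ (μ + 15) * x ^ q') ^ 2 := Nat.pow_le_pow_left (hΔ' v hv) 2
        _ = x ^ ((μ + 15 + q') * 2) := by rw [← pow_add, ← pow_mul]
        _ ≤ x ^ (savingExp k + (2 * q' - (μ + 17))) := by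
            refine Nat.pow_le_pow_right hx1 ?_
            unfold savingExp
            omega
        _ = _ := pow_add _ _ _
    · calc ∑ u ∈ N, #{w ∈ N | G.Crowded (x ^ μ) u w} ≤ ∑ _u ∈ N, #N :=
            sum_le_sum fun u _ => card_filter_le _ _
        _ = #N ^ 2 := by rw [sum_const, smul_eq_mul, sq]
        _ ≤ (x ^ crowdExp k (savingExp k)) ^ 2 := Nat.pow_le_pow_left (by omega) 2
        _ = x ^ (crowdExp k (savingExp k) * 2) := by rw [pow_mul]
        _ ≤ _ := Nat.pow_le_pow_right hx1 (by omega)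
  have hfew := sum_adj_le_of_almost_regular (κ := μ + 15) (M := x ^ μ) h.longInducedCycleFree
    (by positivity) hkx' hΔ' hcr (by
      rw [← pow_add, ← pow_mul]
      exact Nat.pow_le_pow_right hx1 (by omega)) (by
      rw [← pow_add]
      exact Nat.pow_le_pow_right hx1 (by omega))
  have hA₁c : #A₁ ≤ n := card_le_card sdiff_subset
  have hfinal : n * (x ^ q' * x ^ 3) ≤ n * (x ^ q' * 24) := by
    calc n * (x ^ q' * x ^ 3) = n * x ^ a := by rw [hq', pow_add]
      _ ≤ n * d := Nat.mul_le_mul_left _ hxd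
      _ ≤ 4 * (6 * #A₁ * x ^ q') := hmany.trans (Nat.mul_le_mul_left _ hfew)
      _ ≤ 4 * (6 * n * x ^ q') := by gcongr
      _ = _ := by ring
  have h1 := Nat.le_of_mul_le_mul_left (Nat.le_of_mul_le_mul_left hfinal hn0) (by positivity)
  have h2 : x ≤ x ^ 3 := Nat.le_self_pow (by omega) x
  omega

end MinDegree

/-! ### The degeneracy bound -/

/-- An exponent such that `ℓ ^ constExp k`, for `ℓ ≥ 2`, exceeds all constants depending on `k`. -/
def constExp (k : ℕ) : ℕ := (2 * k) ^ 3 * 2 ^ (2 * k) + degExp k + 2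

theorem exists_pow_le_and_le_pow {b a d : ℕ} (ha : 1 ≤ a) (hb : 2 ^ a ≤ b) (hd : b ^ a ≤ d) :
    ∃ x, b ≤ x ∧ x ^ a ≤ d ∧ d ≤ x ^ (a + 1) := by
  have hbd : b ≤ d := (Nat.le_self_pow (by omega) b).trans hd
  have hspec := Nat.findGreatest_spec (P := fun x => x ^ a ≤ d) hbd hd
  have hle := Nat.le_findGreatest (P := fun x => x ^ a ≤ d) hbd hd
  have hgt := fun y => Nat.findGreatest_is_greatest (P := fun x => x ^ a ≤ d) (n := d) (k := y)
  generalize Nat.findGreatest (fun x => x ^ a ≤ d) d = x at hspec hle hgt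
  refine ⟨x, hle, hspec, ?_⟩
  have hx1 : 1 ≤ x := (Nat.one_le_two_pow.trans hb).trans hle
  have h1 : d ≤ (x + 1) ^ a := by
    by_contra hcon
    have h2 : x + 1 ≤ d := (Nat.le_self_pow (Nat.ne_of_gt ha) (x + 1)).trans (not_le.1 hcon).le
    exact hgt (x + 1) (Nat.lt_succ_self x) h2 (not_le.1 hcon).le
  calc d ≤ (x + 1) ^ a := h1
    _ ≤ (2 * x) ^ a := Nat.pow_le_pow_left (by omega) a
    _ = 2 ^ a * x ^ a := mul_pow _ _ _
    _ ≤ x * x ^ a := Nat.mul_le_mul_right _ (hb.trans hle)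
    _ = _ := by ring

theorem BicliqueFree.isDegenerate {V : Type*} [Finite V] {G : SimpleGraph V} {ℓ k : ℕ} (hk : 2 ≤ k)
    (hG : G.LongInducedCycleFree (4 * k)) (hB : G.BicliqueFree ℓ) :
    G.IsDegenerate (ℓ ^ (constExp k * degExp k)) := by
  classical
  have := Fintype.ofFinite V
  rcases Nat.lt_or_ge ℓ 2 with hℓ | hℓ
  · -- a graph without `K_{1,1}` has no edges, and no graph is without `K_{0,0}`
    intro s hs
    obtain ⟨v, hv⟩ := hs
    refine ⟨⟨v, hv⟩, ?_⟩
    have hempty : (G.induce s).neighborSet ⟨v, hv⟩ = ∅ := by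
      rw [Set.eq_empty_iff_forall_notMem]
      rintro ⟨w, hw⟩ hvw
      have hvw' : G.Adj v w := hvw
      interval_cases ℓ
      · obtain ⟨u, hu, -⟩ := hB ∅ ∅ rfl rfl
        simp at hu
      · obtain ⟨u, hu, u', hu', huu⟩ := hB {v} {w} (card_singleton _) (card_singleton _)
        rw [mem_singleton] at hu hu'
        exact huu (hu ▸ hu' ▸ hvw')
    rw [hempty, Set.encard_empty]
    exact zero_le
  by_contra hcon
  have hex : ∃ d, G.IsDegenerate d := by
    refine ⟨Fintype.card V, fun s hs => ?_⟩
    obtain ⟨v, hv⟩ := hs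
    refine ⟨⟨v, hv⟩, ?_⟩
    have hs' : s = (s.toFinset : Set V) := by simp
    revert hv
    rw [hs']
    intro hv
    rw [encard_neighborSet_induce]
    exact_mod_cast card_le_univ _
  have hspec := Nat.find_spec hex
  have hmin := fun m (hm : m < Nat.find hex) => Nat.find_min hex hm
  generalize Nat.find hex = d at hspec hmin
  have hD : ℓ ^ (constExp k * degExp k) < d := by
    by_contra hle
    refine hcon fun s hs => ?_
    obtain ⟨v, hv⟩ := hspec s hs
    exact ⟨v, hv.trans (by exact_mod_cast not_lt.1 hle)⟩
  have hnot := hmin (d - 1) (by omega)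
  unfold IsDegenerate at hnot
  push Not at hnot
  obtain ⟨s, hs, hsd⟩ := hnot
  have hs' : s = (s.toFinset : Set V) := by simp
  rw [hs'] at hs hsd
  set S := s.toFinset with hSdef
  have hdegen : G.DegenerateOn S d := by
    intro T _ hT
    obtain ⟨⟨v, hv⟩, hvd⟩ := hspec (T : Set V) hT
    rw [encard_neighborSet_induce] at hvd
    exact ⟨v, hv, by exact_mod_cast hvd⟩
  have hminS : ∀ v ∈ S, d ≤ #{w ∈ S | G.Adj v w} := by
    intro v hv
    have h1 := hsd ⟨v, hv⟩
    rw [encard_neighborSet_induce] at h1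
    have h2 : d - 1 < #{w ∈ S | G.Adj v w} := by exact_mod_cast h1
    omega
  have hpow : ∀ c ≤ constExp k, ∀ m, m ≤ 2 ^ c → m ≤ ℓ ^ constExp k := fun c hc m hm =>
    hm.trans ((Nat.pow_le_pow_left hℓ c).trans (Nat.pow_le_pow_right (by omega) hc))
  obtain ⟨x, hbx, hxd, hdx⟩ := exists_pow_le_and_le_pow (b := ℓ ^ constExp k) (a := degExp k)
    (d := d)
    (by unfold degExp; omega) (hpow (degExp k) (by unfold constExp; omega) _ le_rfl)
    (by rw [← pow_mul]; exact hD.le)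
  have htame : G.IsTame ℓ x k :=
    { bicliqueFree := hB
      two_mul_le := by
        refine le_trans ?_ hbx
        calc 2 * ℓ ≤ ℓ * ℓ := Nat.mul_le_mul_right _ hℓ
          _ = ℓ ^ 2 := by ring
          _ ≤ ℓ ^ constExp k := Nat.pow_le_pow_right (by omega) (by unfold constExp; omega)
      two_le := hk
      const_le := (hpow ((2 * k) ^ 3 * 2 ^ (2 * k)) (by unfold constExp; omega) _
        Nat.lt_two_pow_self.le).trans hbx
      longInducedCycleFree := hG }
  exact htame.false_of_minDegree (S := S) (by exact_mod_cast hs) le_rfl hdx hxd hdegen hminS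

theorem bicliqueFree_of_free {V : Type*} {G : SimpleGraph V} {ℓ : ℕ}
    (h : (completeBipartiteGraph (Fin ℓ) (Fin ℓ)).Free G) : G.BicliqueFree ℓ := by
  intro X Y hX hY
  by_contra hcon
  push Not at hcon
  exact h (completeBipartiteGraph_isContained_iff.2
    ⟨X, Y, by simpa using hX, by simpa using hY, fun u hu w hw => hcon u hu w hw⟩)

end SimpleGraph

theorem theorem3 :
    ∃ f : ℕ → ℕ, ∀ (t ℓ : ℕ) (V : Type*) [Finite V] (G : SimpleGraph V),
      G.LongInducedCycleFree t →
      (completeBipartiteGraph (Fin ℓ) (Fin ℓ)).Free G →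
      G.degeneracy ≤ ((ℓ ^ f t : ℕ) : ℕ∞) := by
  refine ⟨fun t => SimpleGraph.constExp (t + 2) * SimpleGraph.degExp (t + 2), ?_⟩
  intro t ℓ V _ G hG hfree
  exact iInf₂_le _ ((SimpleGraph.bicliqueFree_of_free hfree).isDegenerate (k := t + 2) (by omega)
    fun n hn3 hn => hG n hn3 (by omega))
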